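/- **Theorem 2.1 (Two-weighted estimates for $\mathcal M_{\mathcal R,\alpha}$).** Let $m,n\ge 1$, and let $\mathcal R$ be the family of all bounded nondegenerate rectangles in $\mathbb R^n$ with sides parallel to the coordinate axes. For $0<\alpha<mn$, $\vec f=(f_1,\dots,f_m)$ and $x\in\mathbb R^n$ put $$\mathcal M_{\mathcal R,\alpha}(\vec f)(x)=\sup_{R\in\mathcal R,\ R\ni x}\ \prod_{i=1}^m\frac1{|R|^{1-\frac{\alpha}{mn}}}\int_R|f_i(y)|\,dy .$$ Let $\mathcal{DR}\subset\mathcal R$ be the family of all dyadic rectangles, that is, of all products $\prod_{j=1}^n[k_j2^{l_j},(k_j+1)2^{l_j})$ with $k_j,l_j\in\mathbb Z$, and let $\mathcal M^d_{\mathcal R,\alpha}$ be defined in the same way with $\mathcal{DR}$ in place of $\mathcal R$. A nonnegative measurable function $w$ on $\mathbb R^n$ satisfies the *dyadic reverse doubling condition* if it is locally integrable and there is a constant $d>1$ with $$d\int_I w\,dx\le\int_J w\,dx\qquad\text{for all } I,J\in\mathcal{DR}\text{ with } I\subset J,\ |I|=2^{-n}|J| .$$ Let $0<\alpha<mn$,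 $1<p_1,\dots,p_m<\infty$, $\frac1p=\frac1{p_1}+\dots+\frac1{p_m}$, $p_i'=\frac{p_i}{p_i-1}$ and $0<p<q<\infty$. Let $\nu,\omega_1,\dots,\omega_m:\mathbb R^n\to[0,\infty)$ be measurable, and assume that each $\omega_i^{1-p_i'}$ (with value $\infty$ where $\omega_i=0$) satisfies the dyadic reverse doubling condition. Then the following three statements are equivalent. 1. $$\sup_{R\in\mathcal R}|R|^{\frac\alpha n+\frac1q-\frac1p}\left(\frac1{|R|}\int_R\nu\,dx\right)^{\frac1q}\prod_{i=1}^m\left(\frac1{|R|}\int_R\omega_i^{1-p_i'}\,dx\right)^{\frac1{p_i'}}<\infty .$$ 2. There is a finite constant $C$ such that for all (real or complex valued) $f_i\in L^{p_i}(\omega_i)$, $i=1,\dots,m$, $$\|\mathcal M_{\mathcal R,\alpha}(\vec f)\|_{L^{q,\infty}(\nu)}=\sup_{t>0}t\,\nu\big(\{x:\mathcal M_{\mathcal R,\alpha}(\vec f)(x)>t\}\big)^{\frac1q}\le C\prod_{i=1}^m\|f_i\|_{L^{p_i}(\omega_i)} .$$ 3. There is a finite constant $C$ such that for all (real or complex valued)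 $f_i\in L^{p_i}(\omega_i)$, $i=1,\dots,m$, $$\|\mathcal M_{\mathcal R,\alpha}(\vec f)\|_{L^q(\nu)}\le C\prod_{i=1}^m\|f_i\|_{L^{p_i}(\omega_i)} .$$ Here $L^r(w)$ is the space $L^r$ with respect to the measure $w(x)\,dx$, and $\nu(E)=\int_E\nu\,dx$. Likewise, the three statements obtained by replacing $\mathcal R$ by $\mathcal{DR}$ and $\mathcal M_{\mathcal R,\alpha}$ by $\mathcal M^d_{\mathcal R,\alpha}$ throughout are equivalent to each other. -/

import Mathlib

open MeasureTheory
open scoped ENNReal NNReal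

noncomputable section

/-- All rectangles of `ℝⁿ` with sides parallel to the axes: products of bounded nondegenerate
intervals. The intervals are taken half-open, so that dyadic rectangles are rectangles; the
suprema below are the same for open or closed rectangles. -/
def axisRectangles (n : ℕ) : Set (Set (Fin n → ℝ)) :=
  {R | ∃ a b : Fin n → ℝ, (∀ j, a j < b j) ∧ R = Set.univ.pi fun j => Set.Ico (a j) (b j)}

/-- All dyadic rectangles of `ℝⁿ`: products of dyadic intervals `[k 2^l, (k+1) 2^l)` whose
lengths may differ from one coordinate to another. -/
def dyadicRectangles (n : ℕ) : Set (Set (Fin n → ℝ)) :=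
  {R | ∃ k l : Fin n → ℤ,
    R = Set.univ.pi fun j => Set.Ico ((k j : ℝ) * 2 ^ l j) (((k j : ℝ) + 1) * 2 ^ l j)}

/-- The dyadic reverse doubling condition, for a function with values in `[0, ∞]`. -/
def DyadicReverseDoubling {n : ℕ} (w : (Fin n → ℝ) → ℝ≥0∞) : Prop :=
  AEMeasurable w volume ∧
  (∀ K : Set (Fin n → ℝ), IsCompact K → ∫⁻ x in K, w x < ∞) ∧
  ∃ d : ℝ≥0, 1 < d ∧
    ∀ I ∈ dyadicRectangles n, ∀ J ∈ dyadicRectangles n,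
      I ⊆ J → volume I = volume J / 2 ^ n →
        (d : ℝ≥0∞) * ∫⁻ x in I, w x ≤ ∫⁻ x in J, w x

/-- The dual weight `w ^ (1 - p')`, where `p' = p / (p - 1)`; its value is `∞` where `w = 0`. -/
def dualWeight {n : ℕ} (p : ℝ) (w : (Fin n → ℝ) → ℝ≥0) (x : Fin n → ℝ) : ℝ≥0∞ :=
  (w x : ℝ≥0∞) ^ (1 - p.conjExponent)

/-- The multilinear fractional maximal operator over a family `𝓑` of sets. -/
def multilinearFractionalMaximal {n m : ℕ} {𝕜 : Type*} [RCLike 𝕜]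
    (𝓑 : Set (Set (Fin n → ℝ))) (α : ℝ) (f : Fin m → (Fin n → ℝ) → 𝕜) (x : Fin n → ℝ) : ℝ≥0∞ :=
  ⨆ R ∈ 𝓑, ⨆ _ : x ∈ R,
    ∏ i, (∫⁻ y in R, ‖f i y‖ₑ) / volume R ^ (1 - α / ((m : ℝ) * n))

/-- The supremum in the two-weight condition, over a family `𝓑` of sets; here `p` is the
exponent with `1/p = ∑ 1/pᵢ`. -/
def twoWeightConstant {n m : ℕ} (𝓑 : Set (Set (Fin n → ℝ))) (α p q : ℝ) (ps : Fin m → ℝ)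
    (ω : Fin m → (Fin n → ℝ) → ℝ≥0) (ν : (Fin n → ℝ) → ℝ≥0) : ℝ≥0∞ :=
  ⨆ R ∈ 𝓑, volume R ^ (α / n + 1 / q - 1 / p)
    * ((∫⁻ x in R, (ν x : ℝ≥0∞)) / volume R) ^ (1 / q)
    * ∏ i, ((∫⁻ x in R, dualWeight (ps i) (ω i) x) / volume R) ^ (1 / (ps i).conjExponent)

/-- The measure `w(x) dx` on `ℝⁿ`. -/
def weightMeasure {n : ℕ} (w : (Fin n → ℝ) → ℝ≥0) : Measure (Fin n → ℝ) :=
  volume.withDensity fun x => (w x : ℝ≥0∞)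

/-- The weak `L^q` quasinorm `sup_{t > 0} t μ{g > t}^{1/q}` of a nonnegative function. -/
def weakLpNorm {X : Type*} [MeasurableSpace X] (g : X → ℝ≥0∞) (q : ℝ) (μ : Measure X) : ℝ≥0∞ :=
  ⨆ t : ℝ≥0, (t : ℝ≥0∞) * μ {x | (t : ℝ≥0∞) < g x} ^ (1 / q)

/-- The weak type bound `L^{p₁}(ω₁) × ⋯ × L^{p_m}(ω_m) → L^{q,∞}(ν)` for the maximal operator. -/
def WeakTypeBound (𝕜 : Type*) [RCLike 𝕜] {n m : ℕ} (𝓑 : Set (Set (Fin n → ℝ))) (α q : ℝ)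
    (ps : Fin m → ℝ) (ω : Fin m → (Fin n → ℝ) → ℝ≥0) (ν : (Fin n → ℝ) → ℝ≥0) : Prop :=
  ∃ C : ℝ≥0, ∀ f : Fin m → (Fin n → ℝ) → 𝕜,
    (∀ i, MemLp (f i) (ENNReal.ofReal (ps i)) (weightMeasure (ω i))) →
      weakLpNorm (multilinearFractionalMaximal 𝓑 α f) q (weightMeasure ν)
        ≤ C * ∏ i, eLpNorm (f i) (ENNReal.ofReal (ps i)) (weightMeasure (ω i))

/-- The strong type bound `L^{p₁}(ω₁) × ⋯ × L^{p_m}(ω_m) → L^q(ν)` for the maximal operator. -/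
def StrongTypeBound (𝕜 : Type*) [RCLike 𝕜] {n m : ℕ} (𝓑 : Set (Set (Fin n → ℝ))) (α q : ℝ)
    (ps : Fin m → ℝ) (ω : Fin m → (Fin n → ℝ) → ℝ≥0) (ν : (Fin n → ℝ) → ℝ≥0) : Prop :=
  ∃ C : ℝ≥0, ∀ f : Fin m → (Fin n → ℝ) → 𝕜,
    (∀ i, MemLp (f i) (ENNReal.ofReal (ps i)) (weightMeasure (ω i))) →
      eLpNorm (multilinearFractionalMaximal 𝓑 α f) (ENNReal.ofReal q) (weightMeasure ν)
        ≤ C * ∏ i, eLpNorm (f i) (ENNReal.ofReal (ps i)) (weightMeasure (ω i))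

end

/-! ### Powers of series in `[0, ∞]`. -/

section ENNRealSums

/-! Let σᵢ be the measure with density `ωᵢ ^ (1 - pᵢ')`. Testing either norm bound on the functions
1_R ωᵢ^(1 - pᵢ') gives the two-weight condition (`twoWeightConstant_lt_top`). The substance is the
converse, with the weak bound obtained by Chebyshev's inequality.

The q-th power of the maximal function is at most a constant times ∑_Q T_Q^q 1_Q over a countable
family of rectangles, where T_Q is the product attached to Q (`exists_maximal_le`). The two-weight
condition bounds T_Q^q ν(Q) by a constant times ∏ aᵢ(Q)^q, with aᵢ(Q) = σᵢ(Q)^(-1/pᵢ') ∫_Q |fᵢ|.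
Since ∑ p/pᵢ = 1, Hölder's inequality leaves the sums ∑_Q aᵢ(Q)^r with r = q pᵢ/p, and q > p means r
> pᵢ. What is needed is thus a Carleson embedding L^p → ℓ^r for r > p (`exists_tsum_dyadicBox_le`).

By duality it becomes a bound of ∑_Q b_Q σ(Q)^(-1/p') 1_Q in L^{p'}(σ) by the ℓ^{r'} norm of b,
where r' < p'. For an integral exponent N the N-th power is expanded (`lintegral_tsum_pow_le`).
Dyadic rectangles need not be nested, but N of them with a common point meet in a dyadic rectangle P
of which all are ancestors. For fixed relative levels the sum over P is estimated by Hölder's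
inequality, with a power of σ(P)/σ(ancestor) to spare. Reverse doubling makes this ratio decay
geometrically in the number of generations (`DyadicReverseDoubling.exists_ancestor_le`), so the
relative levels can be summed.

For general rectangles the countable family is that of doubled dyadic boxes, each a union of 2^n
dyadic ones. -/

theorem ENNReal.tsum_fin_pi_prod {α : Type*} :
    ∀ {N : ℕ} (g : Fin N → α → ℝ≥0∞), ∑' f : Fin N → α, ∏ i, g i (f i) = ∏ i, ∑' a, g i a
  | 0, g => by simp [tsum_fintype]
  | N + 1, g => by
    rw [← (Fin.consEquiv fun _ : Fin (N + 1) => α).tsum_eq, Fin.prod_univ_succ,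
      ← ENNReal.tsum_fin_pi_prod fun i => g i.succ]
    simp only [Fin.consEquiv, Equiv.coe_fn_mk, Fin.prod_univ_succ, Fin.cons_zero, Fin.cons_succ]
    rw [ENNReal.tsum_prod (f := fun a (b : Fin N → α) => g 0 a * ∏ i, g i.succ (b i))]
    simp_rw [ENNReal.tsum_mul_left, ENNReal.tsum_mul_right]

theorem ENNReal.tsum_pow_eq_tsum_prod {α : Type*} (N : ℕ) (g : α → ℝ≥0∞) :
    (∑' a, g a) ^ N = ∑' f : Fin N → α, ∏ i, g (f i) := by
  rw [ENNReal.tsum_fin_pi_prod fun _ => g]; simp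

/-- Subadditivity of `x ^ t`; it reduces a real exponent in the dual embedding to a larger integer.
-/
theorem ENNReal.tsum_rpow_le_tsum_rpow {α : Type*} (g : α → ℝ≥0∞) {t : ℝ} (h0 : 0 < t)
    (h1 : t ≤ 1) : (∑' a, g a) ^ t ≤ ∑' a, g a ^ t := by
  rw [← ENNReal.le_rpow_inv_iff h0]
  refine ENNReal.summable.tsum_le_of_sum_le fun s => ?_
  rw [ENNReal.le_rpow_inv_iff h0]
  refine le_trans ?_ (ENNReal.sum_le_tsum s)
  classical
  induction s using Finset.induction_on with
  | empty => simp [h0]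
  | insert a s ha ih =>
    rw [Finset.sum_insert ha, Finset.sum_insert ha]
    exact (ENNReal.rpow_add_le_add_rpow _ _ h0.le h1).trans (by gcongr)

/-- A nonnegative integer vector dominates vectors of every smaller sum. -/
theorem exists_le_sum_eq {ι : Type*} [Fintype ι] (k : ι → ℕ) :
    ∀ t ≤ ∑ j, k j, ∃ k' : ι → ℕ, k' ≤ k ∧ ∑ j, k' j = t
  | 0, _ => ⟨0, fun _ => Nat.zero_le _, by simp⟩
  | t + 1, ht => by
    classical
    obtain ⟨k', hk, hs⟩ := exists_le_sum_eq k t (by omega)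
    obtain ⟨j, -, hj⟩ := Finset.exists_lt_of_sum_lt (s := Finset.univ) (f := k') (g := k)
      (by omega)
    refine ⟨Function.update k' j (k' j + 1), fun i => ?_, ?_⟩
    · by_cases h : i = j
      · subst h; simpa using hj
      · simpa [h] using hk i
    · rw [Finset.sum_update_of_mem (Finset.mem_univ j), ← hs,
        Finset.sum_eq_add_sum_sdiff_singleton_of_mem (Finset.mem_univ j) k']
      omega

end ENNRealSums

/-! ### Dyadic rectangles and their ancestors. -/

section DyadicGrid

variable {n : ℕ}

/-- The position of the dyadic rectangle with side lengths `2 ^ l j` that contains `x`. -/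
noncomputable def dyadicCell (l : Fin n → ℤ) (x : Fin n → ℝ) : Fin n → ℤ :=
  fun j => ⌊x j / 2 ^ l j⌋

/-- The dyadic rectangle with levels `Q.1` and position `Q.2`. -/
def dyadicBox (Q : (Fin n → ℤ) × (Fin n → ℤ)) : Set (Fin n → ℝ) :=
  {x | dyadicCell Q.1 x = Q.2}

/-- The levels and position of the dyadic rectangle obtained by moving up `k j` generations
in the `j`-th coordinate. -/
def dyadicAncestor (k : Fin n → ℕ) (Q : (Fin n → ℤ) × (Fin n → ℤ)) :
    (Fin n → ℤ) × (Fin n → ℤ) :=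
  (fun j => Q.1 j + k j, fun j => Q.2 j / 2 ^ k j)

theorem dyadicBox_eq_pi (Q : (Fin n → ℤ) × (Fin n → ℤ)) :
    dyadicBox Q = Set.univ.pi fun j =>
      Set.Ico ((Q.2 j : ℝ) * 2 ^ Q.1 j) (((Q.2 j : ℝ) + 1) * 2 ^ Q.1 j) := by
  ext x
  have h2 : ∀ j, (0 : ℝ) < 2 ^ Q.1 j := fun j => by positivity
  simp only [dyadicBox, dyadicCell, Set.mem_ofPred_eq, funext_iff, Set.mem_pi, Set.mem_univ,
    true_imp_iff, Set.mem_Ico, Int.floor_eq_iff]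
  refine forall_congr' fun j => ?_
  rw [le_div_iff₀ (h2 j), div_lt_iff₀ (h2 j)]

theorem dyadicBox_mem (Q : (Fin n → ℤ) × (Fin n → ℤ)) : dyadicBox Q ∈ dyadicRectangles n :=
  ⟨Q.2, Q.1, dyadicBox_eq_pi Q⟩

theorem exists_dyadicBox_eq {R : Set (Fin n → ℝ)} (hR : R ∈ dyadicRectangles n) :
    ∃ Q, R = dyadicBox Q := by
  obtain ⟨k, l, rfl⟩ := hR
  exact ⟨(l, k), (dyadicBox_eq_pi (l, k)).symm⟩

theorem measurable_dyadicCell (l : Fin n → ℤ) : Measurable (dyadicCell l) :=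
  measurable_pi_lambda _ fun j => Int.measurable_floor.comp ((measurable_pi_apply j).div_const _)

theorem measurableSet_dyadicBox (Q : (Fin n → ℤ) × (Fin n → ℤ)) : MeasurableSet (dyadicBox Q) :=
  measurable_dyadicCell Q.1 (measurableSet_singleton Q.2)

theorem mem_dyadicBox_cell (l : Fin n → ℤ) (x : Fin n → ℝ) : x ∈ dyadicBox (l, dyadicCell l x) :=
  rfl

/-- Floors compose, ⌊⌊y⌋ / 2^k⌋ = ⌊y / 2^k⌋, so an ancestor of the cell of x is again the cell of x
at higher levels. -/
theorem dyadicAncestor_cell (k : Fin n → ℕ) (l : Fin n → ℤ) (x : Fin n → ℝ) :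
    dyadicAncestor k (l, dyadicCell l x) =
      (fun j => l j + k j, dyadicCell (fun j => l j + k j) x) := by
  refine Prod.ext rfl (funext fun j => ?_)
  simp only [dyadicAncestor, dyadicCell, zpow_add₀ (two_ne_zero' ℝ), ← div_div, zpow_natCast]
  exact_mod_cast (Int.floor_div_natCast (x j / 2 ^ l j) (2 ^ k j)).symm

theorem dyadicBox_subset_ancestor (k : Fin n → ℕ) (Q : (Fin n → ℤ) × (Fin n → ℤ)) :
    dyadicBox Q ⊆ dyadicBox (dyadicAncestor k Q) := by
  intro x hx
  have h := dyadicAncestor_cell k Q.1 x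
  have hx' : dyadicCell Q.1 x = Q.2 := hx
  rw [hx'] at h
  rw [show dyadicAncestor k Q = dyadicAncestor k (Q.1, Q.2) from rfl, h]
  exact mem_dyadicBox_cell _ x

theorem dyadicAncestor_add (k k' : Fin n → ℕ) (Q : (Fin n → ℤ) × (Fin n → ℤ)) :
    dyadicAncestor k (dyadicAncestor k' Q) = dyadicAncestor (k' + k) Q := by
  simp only [dyadicAncestor, Prod.mk.injEq, Pi.add_apply, Nat.cast_add]
  refine ⟨funext fun j => by ring, funext fun j => ?_⟩
  rw [Int.ediv_ediv_of_nonneg (by positivity), pow_add]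

theorem volume_dyadicBox (Q : (Fin n → ℤ) × (Fin n → ℤ)) :
    volume (dyadicBox Q) = ENNReal.ofReal (∏ j, 2 ^ Q.1 j) := by
  rw [dyadicBox_eq_pi, Real.volume_pi_Ico, ENNReal.ofReal_prod_of_nonneg fun j _ => by positivity]
  refine Finset.prod_congr rfl fun j _ => ?_
  congr 1; ring

theorem volume_dyadicBox_ancestor (k : Fin n → ℕ) (Q : (Fin n → ℤ) × (Fin n → ℤ)) :
    volume (dyadicBox Q) = volume (dyadicBox (dyadicAncestor k Q)) / 2 ^ ∑ j, k j := by
  rw [volume_dyadicBox, volume_dyadicBox, ENNReal.eq_div_iff (by positivity) (by simp)]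
  rw [show (2 : ℝ≥0∞) ^ ∑ j, k j = ENNReal.ofReal (2 ^ ∑ j, k j) by
    rw [ENNReal.ofReal_pow (by norm_num)]; simp, ← ENNReal.ofReal_mul (by positivity)]
  congr 1
  simp only [dyadicAncestor]
  rw [← Finset.prod_pow_eq_pow_sum, ← Finset.prod_mul_distrib]
  refine Finset.prod_congr rfl fun j _ => ?_
  rw [zpow_add₀ two_ne_zero, zpow_natCast, mul_comm]

theorem lintegral_dyadicCell (σ : Measure (Fin n → ℝ)) (l : Fin n → ℤ)
    (F : (Fin n → ℤ) → ℝ≥0∞) :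
    ∫⁻ x, F (dyadicCell l x) ∂σ = ∑' c, F c * σ (dyadicBox (l, c)) := by
  rw [← lintegral_map (measurable_of_countable F) (measurable_dyadicCell l), lintegral_countable']
  refine tsum_congr fun c => ?_
  rw [Measure.map_apply (measurable_dyadicCell l) (measurableSet_singleton c)]
  rfl

theorem tsum_lintegral_dyadicCell (σ : Measure (Fin n → ℝ))
    (F : (Fin n → ℤ) × (Fin n → ℤ) → ℝ≥0∞) :
    ∑' l, ∫⁻ x, F (l, dyadicCell l x) ∂σ = ∑' Q, F Q * σ (dyadicBox Q) := by
  simp_rw [fun l => lintegral_dyadicCell σ l fun c => F (l, c)]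
  exact (ENNReal.tsum_prod (f := fun l c => F (l, c) * σ (dyadicBox (l, c)))).symm

/-- The boxes with a given `k`-ancestor partition it. Equivalently, both sides sum over all levels
the integral of `F` at the cell of x, and adding `k` permutes the levels. -/
theorem tsum_ancestor_mul (σ : Measure (Fin n → ℝ)) (k : Fin n → ℕ)
    (F : (Fin n → ℤ) × (Fin n → ℤ) → ℝ≥0∞) :
    ∑' P, F (dyadicAncestor k P) * σ (dyadicBox P) = ∑' Q, F Q * σ (dyadicBox Q) := by
  rw [← tsum_lintegral_dyadicCell σ fun P => F (dyadicAncestor k P),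
    ← tsum_lintegral_dyadicCell σ F, ← (Equiv.addRight fun j => (k j : ℤ)).tsum_eq
      fun l => ∫⁻ x, F (l, dyadicCell l x) ∂σ]
  simp_rw [dyadicAncestor_cell]
  rfl

/-- A dyadic rectangle is determined by ancestors none of whose sides is larger in all of them. -/
theorem dyadicAncestor_injective {N : ℕ} (hN : N ≠ 0) {κ : Fin N → Fin n → ℕ}
    (hκ : ∀ j, ∃ i, κ i j = 0) :
    Function.Injective fun (P : (Fin n → ℤ) × (Fin n → ℤ)) (i : Fin N) =>
      dyadicAncestor (κ i) P := by
  intro P P' h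
  have h' : ∀ i, dyadicAncestor (κ i) P = dyadicAncestor (κ i) P' := fun i => congrFun h i
  refine Prod.ext (funext fun j => ?_) (funext fun j => ?_)
  · have := congrFun (congrArg Prod.fst (h' ⟨0, Nat.pos_of_ne_zero hN⟩)) j
    simpa [dyadicAncestor] using this
  -- An ancestor that moves up no generation in coordinate j keeps the j-th position of the box.
  · obtain ⟨i, hi⟩ := hκ j
    have := congrFun (congrArg Prod.snd (h' i)) j
    simpa [dyadicAncestor, hi] using this

end DyadicGrid

/-! ### The dual Carleson embedding. -/

section DualCarleson

variable {n : ℕ}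

/-- One term of the expansion of the `N`-th power of a sum over dyadic rectangles, in which the
levels of the `N` rectangles are in the fixed relative position `κ`. -/
theorem tsum_prod_ancestor_le {σ : Measure (Fin n → ℝ)} (hσ0 : ∀ Q, σ (dyadicBox Q) ≠ 0)
    (hσ1 : ∀ Q, σ (dyadicBox Q) ≠ ∞) {e : (Fin n → ℕ) → ℝ≥0∞}
    (he : ∀ k P, σ (dyadicBox P) ≤ e k * σ (dyadicBox (dyadicAncestor k P)))
    {N : ℕ} (hN : N ≠ 0) {ρ θ : ℝ} (hρ : 0 < ρ) (hθ0 : 0 ≤ θ) (hθ1 : θ ≤ 1)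
    (hθ : ρ * θ + ρ * ((1 - θ) / N) = 1) {κ : Fin N → Fin n → ℕ} (hκ : ∀ j, ∃ i, κ i j = 0)
    (b : (Fin n → ℤ) × (Fin n → ℤ) → ℝ≥0∞) :
    ∑' P, (∏ i, b (dyadicAncestor (κ i) P) *
        σ (dyadicBox (dyadicAncestor (κ i) P)) ^ (-(1 / N : ℝ))) * σ (dyadicBox P) ≤
      (∏ i, e (κ i) ^ (θ / N)) * (∑' Q, b Q ^ ρ) ^ ((N : ℝ) / ρ) := by
  have hN0 : (0 : ℝ) < N := by exact_mod_cast Nat.pos_of_ne_zero hN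
  have h1θ : 0 ≤ (1 - θ) / N := div_nonneg (by linarith) hN0.le
  -- The fraction of the ancestor's mass carried by P. Hölder's inequality will combine two bounds:
  -- `hprod`, from injectivity, and `hvsum`, from the partition of each ancestor.
  set v : Fin N → (Fin n → ℤ) × (Fin n → ℤ) → ℝ≥0∞ := fun i P =>
    σ (dyadicBox P) / σ (dyadicBox (dyadicAncestor (κ i) P)) with hv
  have hve : ∀ i P, v i P ≤ e (κ i) := fun i P => ENNReal.div_le_of_le_mul (he _ _)
  set B := ∑' Q, b Q ^ ρ with hB
  have hvsum : ∀ i, ∑' P, b (dyadicAncestor (κ i) P) ^ ρ * v i P = B := by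
    intro i
    have := tsum_ancestor_mul σ (κ i) fun Q => b Q ^ ρ / σ (dyadicBox Q)
    rw [hB]
    convert this using 3 with P Q
    · simp only [hv, div_eq_mul_inv]; ring
    · rw [ENNReal.div_mul_cancel (hσ0 _) (hσ1 _)]
  have hprod : ∑' P, ∏ i, b (dyadicAncestor (κ i) P) ^ ρ ≤ B ^ N := by
    rw [hB, ENNReal.tsum_pow_eq_tsum_prod N fun Q => b Q ^ ρ]
    exact ENNReal.tsum_comp_le_tsum_of_injective (dyadicAncestor_injective hN hκ)
      fun f : Fin N → (Fin n → ℤ) × (Fin n → ℤ) => ∏ i, b (f i) ^ ρ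
  have hterm : ∀ P, (∏ i, b (dyadicAncestor (κ i) P) *
        σ (dyadicBox (dyadicAncestor (κ i) P)) ^ (-(1 / N : ℝ))) * σ (dyadicBox P) ≤
      (∏ i, e (κ i) ^ (θ / N)) * ((∏ i, b (dyadicAncestor (κ i) P) ^ ρ) ^ θ *
        ∏ i, (b (dyadicAncestor (κ i) P) ^ ρ * v i P) ^ ((1 - θ) / N)) := by
    intro P
    have hs : σ (dyadicBox P) = ∏ _i : Fin N, σ (dyadicBox P) ^ (1 / N : ℝ) := by
      rw [Finset.prod_const, Finset.card_univ, Fintype.card_fin, ← ENNReal.rpow_mul_natCast,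
        one_div_mul_cancel hN0.ne', ENNReal.rpow_one]
    conv_lhs => rw [hs]
    rw [← Finset.prod_mul_distrib, ← ENNReal.prod_rpow_of_nonneg hθ0, ← Finset.prod_mul_distrib,
      ← Finset.prod_mul_distrib]
    refine Finset.prod_le_prod' fun i _ => ?_
    set a := b (dyadicAncestor (κ i) P)
    calc a * σ (dyadicBox (dyadicAncestor (κ i) P)) ^ (-(1 / N : ℝ)) * σ (dyadicBox P) ^ (1 / N : ℝ)
        = a * v i P ^ (1 / N : ℝ) := by
          rw [hv]
          dsimp only
          rw [ENNReal.div_rpow_of_nonneg _ _ (by positivity), ENNReal.rpow_neg,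
            ENNReal.div_eq_inv_mul]
          ring
      -- Of the power 1/N of v, the part θ/N is kept for the decay `e`, and the part (1 - θ)/N goes
      -- into Hölder's inequality; `hθ` splits the factor a accordingly.
      _ = v i P ^ (θ / N) * ((a ^ ρ) ^ θ * (a ^ ρ * v i P) ^ ((1 - θ) / N)) := by
          rw [ENNReal.mul_rpow_of_nonneg _ _ h1θ, ← ENNReal.rpow_mul, ← ENNReal.rpow_mul]
          have h1 : a = a ^ (ρ * θ) * a ^ (ρ * ((1 - θ) / N)) := by
            rw [← ENNReal.rpow_add_of_nonneg _ _ (by positivity) (by positivity), hθ,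
              ENNReal.rpow_one]
          have h2 : v i P ^ (1 / N : ℝ) = v i P ^ (θ / N) * v i P ^ ((1 - θ) / N) := by
            rw [← ENNReal.rpow_add_of_nonneg _ _ (by positivity) h1θ]
            congr 1; field_simp; ring
          conv_lhs => rw [h1, h2]
          ring
      _ ≤ e (κ i) ^ (θ / N) * ((a ^ ρ) ^ θ * (a ^ ρ * v i P) ^ ((1 - θ) / N)) := by
          gcongr
          exact hve i P
  calc _ ≤ ∑' P, (∏ i, e (κ i) ^ (θ / N)) * ((∏ i, b (dyadicAncestor (κ i) P) ^ ρ) ^ θ *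
        ∏ i, (b (dyadicAncestor (κ i) P) ^ ρ * v i P) ^ ((1 - θ) / N)) :=
        ENNReal.tsum_le_tsum hterm
    _ ≤ (∏ i, e (κ i) ^ (θ / N)) * ((∑' P, ∏ i, b (dyadicAncestor (κ i) P) ^ ρ) ^ θ *
        ∏ i, (∑' P, b (dyadicAncestor (κ i) P) ^ ρ * v i P) ^ ((1 - θ) / N)) := by
        rw [ENNReal.tsum_mul_left]
        gcongr
        have := ENNReal.lintegral_mul_prod_norm_pow_le (μ := Measure.count) Finset.univ
          (g := fun P => ∏ i, b (dyadicAncestor (κ i) P) ^ ρ)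
          (f := fun i P => b (dyadicAncestor (κ i) P) ^ ρ * v i P)
          (measurable_of_countable _).aemeasurable
          (fun i _ => (measurable_of_countable _).aemeasurable) θ (p := fun _ => (1 - θ) / N)
          (by simp; field_simp; ring) hθ0 (fun _ _ => h1θ)
        simpa only [lintegral_count] using this
    _ ≤ (∏ i, e (κ i) ^ (θ / N)) * ((B ^ N) ^ θ * ∏ _i : Fin N, B ^ ((1 - θ) / N)) := by
        simp_rw [hvsum]
        gcongr
    _ = _ := by
        congr 1
        rw [Finset.prod_const, Finset.card_univ, Fintype.card_fin, ← ENNReal.rpow_mul_natCast,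
          ← ENNReal.rpow_natCast, ← ENNReal.rpow_mul,
          ← ENNReal.rpow_add_of_nonneg _ _ (by positivity) (by positivity)]
        congr 1
        field_simp
        field_simp at hθ
        linarith

/-- The Carleson embedding for dyadic rectangles in dual form, for integral exponents. -/
theorem lintegral_tsum_pow_le {σ : Measure (Fin n → ℝ)} (hσ0 : ∀ Q, σ (dyadicBox Q) ≠ 0)
    (hσ1 : ∀ Q, σ (dyadicBox Q) ≠ ∞) {e : (Fin n → ℕ) → ℝ≥0∞}
    (he : ∀ k P, σ (dyadicBox P) ≤ e k * σ (dyadicBox (dyadicAncestor k P)))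
    {N : ℕ} (hN : N ≠ 0) {ρ θ : ℝ} (hρ : 0 < ρ) (hθ0 : 0 ≤ θ) (hθ1 : θ ≤ 1)
    (hθ : ρ * θ + ρ * ((1 - θ) / N) = 1)
    (b : (Fin n → ℤ) × (Fin n → ℤ) → ℝ≥0∞) :
    ∫⁻ x, (∑' l, b (l, dyadicCell l x) *
        σ (dyadicBox (l, dyadicCell l x)) ^ (-(1 / N : ℝ))) ^ N ∂σ ≤
      (∑' k, e k ^ (θ / N)) ^ N * (∑' Q, b Q ^ ρ) ^ ((N : ℝ) / ρ) := by
  set β : (Fin n → ℤ) × (Fin n → ℤ) → ℝ≥0∞ :=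
    fun Q => b Q * σ (dyadicBox Q) ^ (-(1 / N : ℝ)) with hβ
  set G : (Fin N → Fin n → ℤ) → ℝ≥0∞ := fun lam => ∫⁻ x, ∏ i, β (lam i, dyadicCell (lam i) x) ∂σ
  have hmeas : ∀ l : Fin n → ℤ, Measurable fun x => β (l, dyadicCell l x) := fun l =>
    (measurable_of_countable fun c => β (l, c)).comp (measurable_dyadicCell l)
  have hexp : ∫⁻ x, (∑' l, β (l, dyadicCell l x)) ^ N ∂σ = ∑' lam, G lam := by
    rw [← lintegral_tsum fun lam =>
      (Finset.measurable_prod _ fun i _ => hmeas (lam i)).aemeasurable]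
    refine lintegral_congr fun x => ?_
    exact ENNReal.tsum_pow_eq_tsum_prod N fun l => β (l, dyadicCell l x)
  -- The levels of N rectangles are encoded by their coordinatewise minimum, the levels of the
  -- intersection, and by the heights above it, one of which vanishes in each coordinate.
  let K := {κ : Fin N → Fin n → ℕ // ∀ j, ∃ i, κ i j = 0}
  have : Nonempty (Fin N) := ⟨⟨0, Nat.pos_of_ne_zero hN⟩⟩
  let m : (Fin N → Fin n → ℤ) → Fin n → ℤ := fun lam j => Finset.univ.inf' Finset.univ_nonempty
    fun i => lam i j
  have hm : ∀ lam i j, m lam j ≤ lam i j := fun lam i j => Finset.inf'_le _ (Finset.mem_univ i)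
  let φ : (Fin N → Fin n → ℤ) → K × (Fin n → ℤ) := fun lam =>
    (⟨fun i j => (lam i j - m lam j).toNat, fun j => by
      obtain ⟨i, -, hi⟩ := Finset.exists_mem_eq_inf' Finset.univ_nonempty fun i => lam i j
      exact ⟨i, by simp only [m, hi, sub_self, Int.toNat_zero]⟩⟩, m lam)
  let ψ : K × (Fin n → ℤ) → Fin N → Fin n → ℤ := fun z i j => z.2 j + z.1.1 i j
  have hφ : ∀ lam, ψ (φ lam) = lam := fun lam => by
    funext i j
    have := hm lam i j
    simp only [ψ, φ]
    omega
  change ∫⁻ x, (∑' l, β (l, dyadicCell l x)) ^ N ∂σ ≤ _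
  rw [hexp]
  calc ∑' lam, G lam = ∑' lam, G (ψ (φ lam)) := by simp_rw [hφ]
    _ ≤ ∑' z, G (ψ z) := ENNReal.tsum_comp_le_tsum_of_injective
        (Function.LeftInverse.injective hφ) fun z => G (ψ z)
    _ = ∑' (κ : K) (l : Fin n → ℤ), G (ψ (κ, l)) :=
        ENNReal.tsum_prod (f := fun κ l => G (ψ (κ, l)))
    _ ≤ ∑' κ : K, (∏ i, e (κ.1 i) ^ (θ / N)) * (∑' Q, b Q ^ ρ) ^ ((N : ℝ) / ρ) := by
        refine ENNReal.tsum_le_tsum fun κ => ?_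
        refine le_trans (le_of_eq ?_) (tsum_prod_ancestor_le hσ0 hσ1 he hN hρ hθ0 hθ1 hθ κ.2 b)
        rw [← tsum_lintegral_dyadicCell σ fun P => ∏ i, β (dyadicAncestor (κ.1 i) P)]
        simp_rw [dyadicAncestor_cell]
        rfl
    _ ≤ _ := by
        rw [ENNReal.tsum_mul_right, ENNReal.tsum_pow_eq_tsum_prod N fun k => e k ^ (θ / N)]
        gcongr
        exact ENNReal.tsum_comp_le_tsum_of_injective Subtype.val_injective
          fun κ : Fin N → Fin n → ℕ => ∏ i, e (κ i) ^ (θ / N)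

/-- The Carleson embedding for dyadic rectangles in dual form. -/
theorem exists_lintegral_tsum_rpow_le {σ : Measure (Fin n → ℝ)}
    (hσ0 : ∀ Q, σ (dyadicBox Q) ≠ 0) (hσ1 : ∀ Q, σ (dyadicBox Q) ≠ ∞)
    {e : (Fin n → ℕ) → ℝ≥0∞}
    (he : ∀ k P, σ (dyadicBox P) ≤ e k * σ (dyadicBox (dyadicAncestor k P)))
    (hesum : ∀ t : ℝ, 0 < t → ∑' k, e k ^ t ≠ ∞) {p r : ℝ} (hr : 1 < r) (hrp : r < p) :
    ∃ C : ℝ≥0∞, C ≠ ∞ ∧ ∀ b : (Fin n → ℤ) × (Fin n → ℤ) → ℝ≥0∞,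
      ∫⁻ x, (∑' l, b (l, dyadicCell l x) *
        σ (dyadicBox (l, dyadicCell l x)) ^ (-(1 / p))) ^ p ∂σ ≤ C * (∑' Q, b Q ^ r) ^ (p / r) := by
  obtain ⟨N, hN⟩ := exists_nat_ge p
  have hp0 : 0 < p := by linarith
  have hN0 : (0 : ℝ) < N := by linarith
  have hN1 : (1 : ℝ) < N := by linarith
  have hNne : N ≠ 0 := by rintro rfl; simp at hN0
  -- Chosen so that (b^(p/N))^ρ = b^r: the integral case will be applied to b^(p/N).
  set ρ := r * N / p with hρ
  have hρ0 : 0 < ρ := by positivity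
  have hρ1 : 1 ≤ ρ := by rw [hρ, le_div_iff₀ hp0]; nlinarith
  have hρN : ρ < N := by rw [hρ, div_lt_iff₀ hp0]; nlinarith
  -- The solution of `hθ` below. It is positive exactly because r < p, and positivity is what makes
  -- ∑ e^(θ/N) finite.
  set θ := (N - ρ) / (ρ * (N - 1)) with hθd
  have hθ0 : 0 < θ := div_pos (by linarith) (mul_pos hρ0 (by linarith))
  have hθ1 : θ ≤ 1 := by
    rw [hθd, div_le_one (mul_pos hρ0 (by linarith))]; nlinarith
  have hθ : ρ * θ + ρ * ((1 - θ) / N) = 1 := by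
    have : θ * (ρ * (N - 1)) = N - ρ := div_mul_cancel₀ _ (mul_pos hρ0 (by linarith)).ne'
    field_simp
    linarith
  refine ⟨(∑' k, e k ^ (θ / N)) ^ N, ENNReal.pow_ne_top (hesum _ (by positivity)), fun b => ?_⟩
  have key := lintegral_tsum_pow_le hσ0 hσ1 he hNne hρ0 hθ0.le hθ1 hθ fun Q => b Q ^ (p / N)
  have e1 : ∀ Q, (b Q ^ (p / N)) ^ ρ = b Q ^ r := fun Q => by
    rw [← ENNReal.rpow_mul]; congr 1; rw [hρ]; field_simp
  have e2 : (N : ℝ) / ρ = p / r := by rw [hρ]; field_simp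
  simp_rw [e1] at key
  rw [e2] at key
  refine le_trans (lintegral_mono fun x => ?_) key
  have h3 := ENNReal.tsum_rpow_le_tsum_rpow (fun l => b (l, dyadicCell l x) *
    σ (dyadicBox (l, dyadicCell l x)) ^ (-(1 / p))) (t := p / N) (by positivity)
    ((div_le_one hN0).2 hN)
  calc _ = ((∑' l, b (l, dyadicCell l x) *
          σ (dyadicBox (l, dyadicCell l x)) ^ (-(1 / p))) ^ (p / N)) ^ N := by
        rw [← ENNReal.rpow_mul_natCast]; congr 1; field_simp
    _ ≤ _ := by
        gcongr
        refine h3.trans (le_of_eq (tsum_congr fun l => ?_))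
        rw [ENNReal.mul_rpow_of_nonneg _ _ (by positivity), ← ENNReal.rpow_mul]
        congr 2; field_simp

end DualCarleson

/-! ### Consequences of reverse doubling. -/

section ReverseDoubling

variable {n : ℕ}

theorem DyadicReverseDoubling.withDensity_dyadicBox_ne_top {w : (Fin n → ℝ) → ℝ≥0∞}
    (hw : DyadicReverseDoubling w) (Q : (Fin n → ℤ) × (Fin n → ℤ)) :
    volume.withDensity w (dyadicBox Q) ≠ ∞ := by
  rw [withDensity_apply _ (measurableSet_dyadicBox Q), dyadicBox_eq_pi]
  refine ne_top_of_le_ne_top (hw.2.1 _ (isCompact_univ_pi fun j => isCompact_Icc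
    (a := (Q.2 j : ℝ) * 2 ^ Q.1 j) (b := ((Q.2 j : ℝ) + 1) * 2 ^ Q.1 j))).ne ?_
  exact lintegral_mono_set (Set.pi_mono fun j _ => Set.Ico_subset_Icc_self)

/-- Every n generations gain a factor 1/d, however they are distributed over the coordinates. Hence
e(k) = d δ^|k| with δ = d^(-1/n) works, and the sum of its t-th powers is a product of n geometric
series. -/
theorem DyadicReverseDoubling.exists_ancestor_le {w : (Fin n → ℝ) → ℝ≥0∞}
    (hw : DyadicReverseDoubling w) (hn : n ≠ 0) :
    ∃ e : (Fin n → ℕ) → ℝ≥0∞,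
      (∀ k P, volume.withDensity w (dyadicBox P) ≤
        e k * volume.withDensity w (dyadicBox (dyadicAncestor k P))) ∧
      ∀ t : ℝ, 0 < t → ∑' k, e k ^ t ≠ ∞ := by
  obtain ⟨-, -, d, hd, hdw⟩ := hw
  set σ := volume.withDensity w
  have hn0 : (0 : ℝ) < n := by exact_mod_cast Nat.pos_of_ne_zero hn
  have hd0 : (0 : ℝ≥0) < d := by positivity
  set δ : ℝ≥0 := d⁻¹ ^ (1 / n : ℝ) with hδ
  have hδ1 : δ < 1 := NNReal.rpow_lt_one (inv_lt_one_of_one_lt₀ hd) (by positivity)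
  have hδn : δ ^ n = d⁻¹ := by
    rw [hδ, ← NNReal.rpow_natCast, ← NNReal.rpow_mul, one_div_mul_cancel hn0.ne', NNReal.rpow_one]
  have hδ0 : 0 < δ := NNReal.rpow_pos (inv_pos.2 hd0)
  have hstep : ∀ (k : Fin n → ℕ) P, ∑ j, k j = n →
      σ (dyadicBox P) ≤ (d⁻¹ : ℝ≥0) * σ (dyadicBox (dyadicAncestor k P)) := by
    intro k P hk
    have hP := hdw _ (dyadicBox_mem P) _ (dyadicBox_mem (dyadicAncestor k P))
      (dyadicBox_subset_ancestor k P) (by rw [volume_dyadicBox_ancestor k P, hk])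
    rw [← withDensity_apply _ (measurableSet_dyadicBox _),
      ← withDensity_apply _ (measurableSet_dyadicBox _)] at hP
    rw [ENNReal.coe_inv hd0.ne']
    calc σ (dyadicBox P) = (d : ℝ≥0∞)⁻¹ * (d * σ (dyadicBox P)) := by
          rw [← mul_assoc, ENNReal.inv_mul_cancel (by exact_mod_cast hd0.ne') ENNReal.coe_ne_top,
            one_mul]
      _ ≤ _ := by gcongr
  have hdec : ∀ (s : ℕ) (k : Fin n → ℕ) P, ∑ j, k j = s →
      σ (dyadicBox P) ≤ ((d * δ ^ s : ℝ≥0) : ℝ≥0∞) * σ (dyadicBox (dyadicAncestor k P)) := by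
    intro s
    induction s using Nat.strong_induction_on with
    | _ s ih =>
      intro k P hk
      -- Below n generations monotonicity suffices, since d δ^s ≥ d δ^n = 1; this is the role of the
      -- prefactor d.
      by_cases hs : s < n
      · have h1 : (1 : ℝ≥0) ≤ d * δ ^ s := by
          calc (1 : ℝ≥0) = d * δ ^ n := by rw [hδn, mul_inv_cancel₀ hd0.ne']
            _ ≤ d * δ ^ s := mul_le_mul' le_rfl (pow_le_pow_of_le_one hδ0.le hδ1.le hs.le)
        calc σ (dyadicBox P) ≤ 1 * σ (dyadicBox (dyadicAncestor k P)) := by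
              rw [one_mul]; exact measure_mono (dyadicBox_subset_ancestor k P)
          _ ≤ _ := by gcongr; exact_mod_cast h1
      · push Not at hs
        obtain ⟨k', hk', hs'⟩ := exists_le_sum_eq k n (by omega)
        have hsum : ∑ j, (k - k') j = s - n := by
          have : ∑ j, (k - k') j + ∑ j, k' j = ∑ j, k j := by
            rw [← Finset.sum_add_distrib]
            exact Finset.sum_congr rfl fun j _ => Nat.sub_add_cancel (hk' j)
          omega
        calc σ (dyadicBox P) ≤ (d⁻¹ : ℝ≥0) * σ (dyadicBox (dyadicAncestor k' P)) := hstep k' P hs'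
          _ ≤ (d⁻¹ : ℝ≥0) * (((d * δ ^ (s - n) : ℝ≥0) : ℝ≥0∞) *
              σ (dyadicBox (dyadicAncestor (k - k') (dyadicAncestor k' P)))) := by
              gcongr
              exact ih (s - n) (by omega) _ _ hsum
          _ = _ := by
              rw [dyadicAncestor_add, add_tsub_cancel_of_le hk', ← mul_assoc, ← ENNReal.coe_mul]
              congr 2
              rw [← hδn, mul_left_comm, ← pow_add, Nat.add_sub_cancel' hs]
  refine ⟨fun k => ((d * δ ^ ∑ j, k j : ℝ≥0) : ℝ≥0∞), fun k P => hdec _ k P rfl, fun t ht => ?_⟩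
  have : ∀ k : Fin n → ℕ, ((d * δ ^ ∑ j, k j : ℝ≥0) : ℝ≥0∞) ^ t =
      (d : ℝ≥0∞) ^ t * ∏ j, ((δ : ℝ≥0∞) ^ t) ^ k j := fun k => by
    rw [ENNReal.coe_mul, ENNReal.mul_rpow_of_nonneg _ _ ht.le, Finset.prod_pow_eq_pow_sum,
      ENNReal.coe_pow, ← ENNReal.rpow_natCast, ← ENNReal.rpow_natCast, ← ENNReal.rpow_mul,
      ← ENNReal.rpow_mul, mul_comm t]
  simp_rw [this]
  rw [ENNReal.tsum_mul_left, ENNReal.tsum_fin_pi_prod fun _ a => ((δ : ℝ≥0∞) ^ t) ^ a]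
  refine ENNReal.mul_ne_top (ENNReal.rpow_ne_top_of_nonneg ht.le ENNReal.coe_ne_top)
    (ENNReal.prod_ne_top fun j _ => ?_)
  rw [ENNReal.tsum_geometric]
  refine ENNReal.inv_ne_top.2 (tsub_pos_of_lt ?_).ne'
  exact ENNReal.rpow_lt_one (by exact_mod_cast hδ1) ht

theorem dualWeight_pos {p : ℝ} (hp : 1 < p) (w : (Fin n → ℝ) → ℝ≥0) (x : Fin n → ℝ) :
    dualWeight p w x ≠ 0 := by
  have h1 := (Real.HolderConjugate.conjExponent hp).symm.lt
  unfold dualWeight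
  intro h
  rcases ENNReal.rpow_eq_zero_iff.1 h with ⟨-, h2⟩ | ⟨h2, -⟩
  · linarith
  · exact ENNReal.coe_ne_top h2

theorem DyadicReverseDoubling.ae_lt_top {w : (Fin n → ℝ) → ℝ≥0∞}
    (hw : DyadicReverseDoubling w) : ∀ᵐ x, w x < ∞ := by
  have h : ∀ᵐ x, ∀ N : ℕ, x ∈ Metric.closedBall (0 : Fin n → ℝ) N → w x < ∞ := by
    rw [ae_all_iff]
    intro N
    rw [← ae_restrict_iff' Metric.isClosed_closedBall.measurableSet]
    exact ae_lt_top' hw.1.restrict (hw.2.1 _ (isCompact_closedBall _ _)).ne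
  filter_upwards [h] with x hx
  obtain ⟨N, hN⟩ := exists_nat_ge (dist x 0)
  exact hx N hN

/-- The dual weight is infinite where the weight vanishes, which local integrability allows only on
a null set. -/
theorem DyadicReverseDoubling.ae_weight_ne_zero {p : ℝ} (hp : 1 < p) {w : (Fin n → ℝ) → ℝ≥0}
    (hw : DyadicReverseDoubling (dualWeight p w)) : ∀ᵐ x, w x ≠ 0 := by
  have h1 := (Real.HolderConjugate.conjExponent hp).symm.lt
  filter_upwards [hw.ae_lt_top] with x hx h0
  rw [dualWeight, h0, ENNReal.coe_zero, ENNReal.zero_rpow_of_neg (by linarith)] at hx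
  exact hx.ne rfl

theorem withDensity_ne_zero {w : (Fin n → ℝ) → ℝ≥0∞} (hw : AEMeasurable w volume)
    (hw0 : ∀ x, w x ≠ 0) {E : Set (Fin n → ℝ)} (hE : volume E ≠ 0) :
    volume.withDensity w E ≠ 0 := by
  rw [Ne, withDensity_apply_eq_zero' hw]
  simpa [hw0] using hE

end ReverseDoubling

/-! ### The Carleson embedding by duality. -/

section Carleson

variable {n : ℕ}

/-- Hölder's inequality for a weight and its dual weight. -/
theorem lintegral_mul_le_dualWeight {p : ℝ} (hp : 1 < p) {w : (Fin n → ℝ) → ℝ≥0}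
    (hw : AEMeasurable w volume) (hRD : DyadicReverseDoubling (dualWeight p w))
    {f h : (Fin n → ℝ) → ℝ≥0∞} (hf : AEMeasurable f volume) (hh : AEMeasurable h volume) :
    ∫⁻ x, f x * h x ≤ (∫⁻ x, f x ^ p * w x) ^ (1 / p) *
      (∫⁻ x, h x ^ p.conjExponent ∂volume.withDensity (dualWeight p w)) ^
        (1 / p.conjExponent) := by
  have hpq := Real.HolderConjugate.conjExponent hp
  have hp0 : 0 < p := hpq.pos
  have hp'0 : 0 < p.conjExponent := hpq.symm.pos
  have hw' : AEMeasurable (fun x => (w x : ℝ≥0∞)) volume := hw.coe_nnreal_ennreal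
  rw [lintegral_withDensity_eq_lintegral_mul₀ hRD.1 (hh.pow_const _)]
  -- Insert ω^(1/p) ω^(-1/p) = 1; the p'-th power of the second factor is the dual weight, as -p'/p
  -- = 1 - p'.
  calc ∫⁻ x, f x * h x
      ≤ ∫⁻ x, (f x * (w x : ℝ≥0∞) ^ (1 / p)) * (h x * (w x : ℝ≥0∞) ^ (-(1 / p))) := by
        refine lintegral_mono_ae ?_
        filter_upwards [hRD.ae_weight_ne_zero hp] with x hx
        refine le_of_eq ?_
        have : (w x : ℝ≥0∞) ^ (1 / p) * (w x : ℝ≥0∞) ^ (-(1 / p)) = 1 := by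
          rw [← ENNReal.rpow_add _ _ (by exact_mod_cast hx) ENNReal.coe_ne_top]; simp
        calc f x * h x = f x * h x * ((w x : ℝ≥0∞) ^ (1 / p) * (w x : ℝ≥0∞) ^ (-(1 / p))) := by
              rw [this, mul_one]
          _ = _ := by ring
    _ ≤ _ := ENNReal.lintegral_mul_le_Lp_mul_Lq volume hpq (hf.mul (hw'.pow_const _))
        (hh.mul (hw'.pow_const _))
    _ = _ := by
        congr 2
        · refine lintegral_congr fun x => ?_
          rw [ENNReal.mul_rpow_of_nonneg _ _ hp0.le, ← ENNReal.rpow_mul, one_div_mul_cancel hp0.ne',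
            ENNReal.rpow_one]
        · refine lintegral_congr fun x => ?_
          rw [ENNReal.mul_rpow_of_nonneg _ _ hp'0.le, ← ENNReal.rpow_mul, Pi.mul_apply, mul_comm,
            dualWeight]
          congr 2
          rw [Real.conjExponent]
          have : p - 1 ≠ 0 := by linarith
          field_simp
          ring

/-- The Carleson embedding for dyadic rectangles. -/
theorem exists_tsum_dyadicBox_le (hn : n ≠ 0) {p r : ℝ} (hp : 1 < p) (hpr : p < r)
    {w : (Fin n → ℝ) → ℝ≥0} (hw : AEMeasurable w volume)
    (hRD : DyadicReverseDoubling (dualWeight p w)) :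
    ∃ C : ℝ≥0∞, C ≠ ∞ ∧ ∀ f : (Fin n → ℝ) → ℝ≥0∞, AEMeasurable f volume →
      ∫⁻ x, f x ^ p * w x ≠ ∞ →
      ∑' Q, (volume.withDensity (dualWeight p w) (dyadicBox Q) ^ (-(1 / p.conjExponent)) *
        ∫⁻ x in dyadicBox Q, f x) ^ r ≤ C * (∫⁻ x, f x ^ p * w x) ^ (r / p) := by
  have hpq := Real.HolderConjugate.conjExponent hp
  have hp0 : 0 < p := hpq.pos
  have hr : 1 < r := hp.trans hpr
  have hrr := Real.HolderConjugate.conjExponent hr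
  have hr0 : 0 < r := hrr.pos
  set p' := p.conjExponent
  set r' := r.conjExponent
  have hp'0 : 0 < p' := hpq.symm.pos
  have hr'0 : 0 < r' := hrr.symm.pos
  have hrp' : r' < p' := by
    have h1 := hpq.inv_add_inv_eq_one
    have h2 := hrr.inv_add_inv_eq_one
    have h3 : r⁻¹ < p⁻¹ := inv_strictAnti₀ hp0 hpr
    exact (inv_lt_inv₀ hp'0 hr'0).1 (by linarith)
  obtain ⟨e, he, hes⟩ := hRD.exists_ancestor_le hn
  set σ := volume.withDensity (dualWeight p w)
  have hσ1 : ∀ Q, σ (dyadicBox Q) ≠ ∞ := hRD.withDensity_dyadicBox_ne_top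
  have hσ0 : ∀ Q, σ (dyadicBox Q) ≠ 0 := fun Q =>
    withDensity_ne_zero hRD.1 (dualWeight_pos hp w) (by
      rw [volume_dyadicBox]
      exact (ENNReal.ofReal_pos.2 (Finset.prod_pos fun j _ => by positivity)).ne')
  obtain ⟨C, hC, hdual⟩ := exists_lintegral_tsum_rpow_le hσ0 hσ1 he hes hrr.symm.lt hrp'
  refine ⟨C ^ (r / p'), ENNReal.rpow_ne_top_of_nonneg (by positivity) hC, fun f hf hI => ?_⟩
  set I := ∫⁻ x, f x ^ p * w x with hIdef
  set a : (Fin n → ℤ) × (Fin n → ℤ) → ℝ≥0∞ := fun Q =>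
    σ (dyadicBox Q) ^ (-(1 / p')) * ∫⁻ x in dyadicBox Q, f x with ha
  -- Finiteness of each term makes the partial sum `A` finite, so that a power of it can be
  -- cancelled in `hroot`.
  have haI : ∀ Q, a Q ≠ ∞ := by
    intro Q
    refine ENNReal.mul_ne_top (by simp [ENNReal.rpow_eq_top_iff, hσ0, hσ1]) ?_
    have := lintegral_mul_le_dualWeight hp hw hRD hf
      ((measurable_const (a := (1 : ℝ≥0∞))).indicator (measurableSet_dyadicBox Q)).aemeasurable
    have h1 : ∫⁻ x in dyadicBox Q, f x =
        ∫⁻ x, f x * (dyadicBox Q).indicator (fun _ => 1) x := by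
      rw [← lintegral_indicator (measurableSet_dyadicBox Q)]
      refine lintegral_congr fun x => ?_
      by_cases hx : x ∈ dyadicBox Q <;> simp [hx]
    have h2 : ∫⁻ x, (dyadicBox Q).indicator (fun _ => (1 : ℝ≥0∞)) x ^ p' ∂σ = σ (dyadicBox Q) := by
      rw [← lintegral_indicator_one (measurableSet_dyadicBox Q)]
      refine lintegral_congr fun x => ?_
      by_cases hx : x ∈ dyadicBox Q <;> simp [hx, hp'0]
    rw [← h1, h2] at this
    exact ne_top_of_le_ne_top (ENNReal.mul_ne_top
      (ENNReal.rpow_ne_top_of_nonneg (by positivity) hI)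
      (ENNReal.rpow_ne_top_of_nonneg (by positivity) (hσ1 Q))) this
  refine ENNReal.summable.tsum_le_of_sum_le fun F => ?_
  set A := ∑ Q ∈ F, a Q ^ r with hA
  have hAtop : A ≠ ∞ := ENNReal.sum_ne_top.2 fun Q _ =>
    ENNReal.rpow_ne_top_of_nonneg hr0.le (haI Q)
  classical
  -- The extremal sequence for ℓ^r duality: a b = a^r = b^r' on F.
  set b : (Fin n → ℤ) × (Fin n → ℤ) → ℝ≥0∞ := fun Q => if Q ∈ F then a Q ^ (r - 1) else 0 with hb
  have hbr : ∑' Q, b Q ^ r' = A := by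
    rw [tsum_eq_sum (s := F) fun Q hQ => by simp [hb, hQ, hr'0]]
    refine Finset.sum_congr rfl fun Q hQ => ?_
    simp only [hb, hQ, if_true]
    rw [← ENNReal.rpow_mul, hrr.sub_one_mul_conj]
  set H : (Fin n → ℝ) → ℝ≥0∞ := fun x => ∑' l, b (l, dyadicCell l x) *
        σ (dyadicBox (l, dyadicCell l x)) ^ (-(1 / p')) with hH
  have hmeas : ∀ l : Fin n → ℤ, Measurable fun x => b (l, dyadicCell l x) *
        σ (dyadicBox (l, dyadicCell l x)) ^ (-(1 / p')) := fun l =>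
    (measurable_of_countable fun c => b (l, c) * σ (dyadicBox (l, c)) ^ (-(1 / p'))).comp
      (measurable_dyadicCell l)
  have hHm : Measurable H := Measurable.tsum hmeas
  have hAH : A = ∫⁻ x, f x * H x := by
    have h1 : ∫⁻ x, f x * H x = ∫⁻ x, H x ∂volume.withDensity f :=
      (lintegral_withDensity_eq_lintegral_mul₀ hf hHm.aemeasurable).symm
    rw [h1, hH, lintegral_tsum fun l => (hmeas l).aemeasurable,
      tsum_lintegral_dyadicCell (volume.withDensity f)
        fun Q => b Q * σ (dyadicBox Q) ^ (-(1 / p')),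
      tsum_eq_sum (s := F) fun Q hQ => by simp [hb, hQ]]
    refine Finset.sum_congr rfl fun Q hQ => ?_
    rw [mul_assoc, withDensity_apply f (measurableSet_dyadicBox Q)]
    change a Q ^ r = b Q * a Q
    simp only [hb, hQ, if_true]
    conv_rhs => rw [← ENNReal.rpow_one (a Q), ← ENNReal.rpow_mul, one_mul]
    rw [← ENNReal.rpow_add_of_nonneg _ _ (by linarith) zero_le_one, sub_add_cancel]
  have hkey : A ≤ I ^ (1 / p) * C ^ (1 / p') * A ^ (1 / r') := by
    calc A = ∫⁻ x, f x * H x := hAH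
      _ ≤ I ^ (1 / p) * (∫⁻ x, H x ^ p' ∂σ) ^ (1 / p') :=
        lintegral_mul_le_dualWeight hp hw hRD hf hHm.aemeasurable
      _ ≤ I ^ (1 / p) * (C * A ^ (p' / r')) ^ (1 / p') := by
        gcongr
        rw [← hbr]
        exact hdual b
      _ = _ := by
        rw [ENNReal.mul_rpow_of_nonneg _ _ (by positivity), ← ENNReal.rpow_mul, mul_assoc]
        congr 3
        field_simp
  have hroot : A ^ (1 / r) ≤ I ^ (1 / p) * C ^ (1 / p') := by
    rcases eq_or_ne A 0 with h0 | h0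
    · rw [h0, ENNReal.zero_rpow_of_pos (by positivity)]; simp
    · have h1 : A ^ (1 / r) * A ^ (1 / r') = A := by
        rw [← ENNReal.rpow_add _ _ h0 hAtop]
        simp only [one_div, hrr.inv_add_inv_eq_one, ENNReal.rpow_one]
      rw [← ENNReal.mul_le_mul_iff_left (c := A ^ (1 / r'))
        (by simp [ENNReal.rpow_eq_zero_iff, h0, hAtop])
        (ENNReal.rpow_ne_top_of_nonneg (by positivity) hAtop), h1]
      exact hkey
  calc A = (A ^ (1 / r)) ^ r := by
        rw [← ENNReal.rpow_mul, one_div_mul_cancel hr0.ne', ENNReal.rpow_one]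
    _ ≤ (I ^ (1 / p) * C ^ (1 / p')) ^ r := by gcongr
    _ = _ := by
        rw [ENNReal.mul_rpow_of_nonneg _ _ hr0.le, ← ENNReal.rpow_mul, ← ENNReal.rpow_mul, mul_comm]
        congr 2 <;> field_simp

end Carleson

/-! ### Passage from dyadic to general rectangles. -/

section DoubledBoxes

variable {n : ℕ}

/-- The rectangle made of the dyadic rectangle `Q` and its neighbours to the right. -/
def doubledBox (Q : (Fin n → ℤ) × (Fin n → ℤ)) : Set (Fin n → ℝ) :=
  Set.univ.pi fun j => Set.Ico ((Q.2 j : ℝ) * 2 ^ Q.1 j) (((Q.2 j : ℝ) + 2) * 2 ^ Q.1 j)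

/-- The neighbour of `Q` in the direction `ε`. -/
def dyadicShift (ε : Fin n → Fin 2) (Q : (Fin n → ℤ) × (Fin n → ℤ)) :
    (Fin n → ℤ) × (Fin n → ℤ) :=
  (Q.1, fun j => Q.2 j + ((ε j : ℕ) : ℤ))

theorem dyadicShift_injective (ε : Fin n → Fin 2) : Function.Injective (dyadicShift ε) := by
  intro Q Q' h
  obtain ⟨h1, h2⟩ := Prod.mk.inj h
  exact Prod.ext h1 (funext fun j => by simpa using congrFun h2 j)

theorem dyadicBox_shift_subset (ε : Fin n → Fin 2) (Q : (Fin n → ℤ) × (Fin n → ℤ)) :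
    dyadicBox (dyadicShift ε Q) ⊆ doubledBox Q := by
  rw [dyadicBox_eq_pi]
  refine Set.pi_mono fun j _ => Set.Ico_subset_Ico ?_ ?_
  · simp only [dyadicShift, Int.cast_add, Int.cast_natCast]
    gcongr
    simp
  · have : ((ε j : ℕ) : ℝ) ≤ 1 := by exact_mod_cast Nat.le_of_lt_succ (ε j).2
    simp only [dyadicShift, Int.cast_add, Int.cast_natCast]
    exact mul_le_mul_of_nonneg_right (by linarith) (by positivity)

theorem doubledBox_subset_iUnion (Q : (Fin n → ℤ) × (Fin n → ℤ)) :
    doubledBox Q ⊆ ⋃ ε : Fin n → Fin 2, dyadicBox (dyadicShift ε Q) := by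
  intro x hx
  have hx' : ∀ j, (Q.2 j : ℝ) * 2 ^ Q.1 j ≤ x j ∧ x j < ((Q.2 j : ℝ) + 2) * 2 ^ Q.1 j :=
    fun j => hx j (Set.mem_univ j)
  have h : ∀ j, ∃ ε : Fin 2, dyadicCell Q.1 x j = Q.2 j + ((ε : ℕ) : ℤ) := by
    intro j
    have h2 : (0 : ℝ) < 2 ^ Q.1 j := by positivity
    have h1 : Q.2 j ≤ dyadicCell Q.1 x j := Int.le_floor.2 ((le_div_iff₀ h2).2 (hx' j).1)
    have h3 : dyadicCell Q.1 x j < Q.2 j + 2 :=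
      Int.floor_lt.2 (by push_cast; exact (div_lt_iff₀ h2).2 (hx' j).2)
    rcases (by omega : dyadicCell Q.1 x j = Q.2 j ∨ dyadicCell Q.1 x j = Q.2 j + 1) with h | h
    · exact ⟨0, by simp [h]⟩
    · exact ⟨1, by simp [h]⟩
  choose ε hε using h
  exact Set.mem_iUnion.2 ⟨ε, funext hε⟩

theorem doubledBox_mem (Q : (Fin n → ℤ) × (Fin n → ℤ)) : doubledBox Q ∈ axisRectangles n :=
  ⟨_, _, fun j => mul_lt_mul_of_pos_right (by linarith) (by positivity), rfl⟩

theorem dyadicRectangles_subset : dyadicRectangles n ⊆ axisRectangles n := by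
  rintro _ ⟨k, l, rfl⟩
  exact ⟨_, _, fun j => mul_lt_mul_of_pos_right (by linarith) (by positivity), rfl⟩

theorem measurableSet_of_mem_axisRectangles {R : Set (Fin n → ℝ)} (hR : R ∈ axisRectangles n) :
    MeasurableSet R := by
  obtain ⟨a, b, -, rfl⟩ := hR
  exact MeasurableSet.univ_pi fun j => measurableSet_Ico

theorem volume_ne_zero_of_mem_axisRectangles {R : Set (Fin n → ℝ)} (hR : R ∈ axisRectangles n) :
    volume R ≠ 0 := by
  obtain ⟨a, b, h, rfl⟩ := hR
  rw [Real.volume_pi_Ico]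
  exact Finset.prod_ne_zero_iff.2 fun j _ => (ENNReal.ofReal_pos.2 (sub_pos.2 (h j))).ne'

theorem exists_compact_superset_of_mem_axisRectangles {R : Set (Fin n → ℝ)}
    (hR : R ∈ axisRectangles n) : ∃ K, IsCompact K ∧ R ⊆ K := by
  obtain ⟨a, b, -, rfl⟩ := hR
  exact ⟨_, isCompact_univ_pi fun j => isCompact_Icc,
    Set.pi_mono fun j _ => Set.Ico_subset_Icc_self⟩

theorem volume_ne_top_of_mem_axisRectangles {R : Set (Fin n → ℝ)} (hR : R ∈ axisRectangles n) :
    volume R ≠ ∞ := by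
  obtain ⟨K, hK, hRK⟩ := exists_compact_superset_of_mem_axisRectangles hR
  exact measure_ne_top_of_subset hRK hK.measure_lt_top.ne

theorem DyadicReverseDoubling.withDensity_ne_top {w : (Fin n → ℝ) → ℝ≥0∞}
    (hw : DyadicReverseDoubling w) {R : Set (Fin n → ℝ)} (hR : R ∈ axisRectangles n) :
    volume.withDensity w R ≠ ∞ := by
  obtain ⟨K, hK, hRK⟩ := exists_compact_superset_of_mem_axisRectangles hR
  rw [withDensity_apply _ (measurableSet_of_mem_axisRectangles hR)]
  exact ne_top_of_le_ne_top (hw.2.1 K hK).ne (lintegral_mono_set hRK)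

/-- If a side lies in (2^l, 2^(l+1)], the dyadic interval of length 2^(l+1) around its left endpoint
and the right neighbour cover it; their total length 4 · 2^l is less than 4 times the side. -/
theorem exists_doubledBox_superset {R : Set (Fin n → ℝ)} (hR : R ∈ axisRectangles n) :
    ∃ Q, R ⊆ doubledBox Q ∧ volume (doubledBox Q) ≤ 4 ^ n * volume R := by
  obtain ⟨a, b, h, rfl⟩ := hR
  have hl : ∀ j, ∃ l : ℤ, b j - a j ∈ Set.Ioc ((2 : ℝ) ^ l) (2 ^ (l + 1)) := fun j =>
    exists_mem_Ioc_zpow (sub_pos.2 (h j)) one_lt_two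
  choose l hl using hl
  have h2 : ∀ j, (0 : ℝ) < 2 ^ (l j + 1) := fun j => by positivity
  refine ⟨(fun j => l j + 1, dyadicCell (fun j => l j + 1) a), ?_, ?_⟩
  · refine Set.pi_mono fun j _ => Set.Ico_subset_Ico ?_ ?_
    · exact (le_div_iff₀ (h2 j)).1 (Int.floor_le _)
    · have h1 := (div_lt_iff₀ (h2 j)).1 (Int.lt_floor_add_one (a j / 2 ^ (l j + 1)))
      have h3 := (hl j).2
      simp only [dyadicCell]
      linarith
  · rw [doubledBox, Real.volume_pi_Ico, Real.volume_pi_Ico,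
      show (4 : ℝ≥0∞) ^ n = ∏ _j : Fin n, 4 by simp, ← Finset.prod_mul_distrib]
    refine Finset.prod_le_prod' fun j _ => ?_
    rw [show (4 : ℝ≥0∞) = ENNReal.ofReal 4 by simp, ← ENNReal.ofReal_mul (by norm_num)]
    refine ENNReal.ofReal_le_ofReal ?_
    have h1 := (hl j).1
    rw [zpow_add_one₀ two_ne_zero]
    linarith

/-- The Carleson embedding for doubled dyadic rectangles. -/
theorem exists_tsum_doubledBox_le (hn : n ≠ 0) {p r : ℝ} (hp : 1 < p) (hpr : p < r)
    {w : (Fin n → ℝ) → ℝ≥0} (hw : AEMeasurable w volume)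
    (hRD : DyadicReverseDoubling (dualWeight p w)) :
    ∃ C : ℝ≥0∞, C ≠ ∞ ∧ ∀ f : (Fin n → ℝ) → ℝ≥0∞, AEMeasurable f volume →
      ∫⁻ x, f x ^ p * w x ≠ ∞ →
      ∑' Q, (volume.withDensity (dualWeight p w) (doubledBox Q) ^ (-(1 / p.conjExponent)) *
        ∫⁻ x in doubledBox Q, f x) ^ r ≤ C * (∫⁻ x, f x ^ p * w x) ^ (r / p) := by
  obtain ⟨C, hC, hbound⟩ := exists_tsum_dyadicBox_le hn hp hpr hw hRD
  have hp' : 0 < p.conjExponent := (Real.HolderConjugate.conjExponent hp).symm.pos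
  set σ := volume.withDensity (dualWeight p w)
  set c : ℝ≥0∞ := (Fintype.card (Fin n → Fin 2) : ℝ≥0∞) with hc
  refine ⟨c ^ (r - 1) * (c * C), ENNReal.mul_ne_top
    (ENNReal.rpow_ne_top_of_nonneg (by linarith) (ENNReal.natCast_ne_top _))
    (ENNReal.mul_ne_top (ENNReal.natCast_ne_top _) hC), fun f hf hI => ?_⟩
  set a : (Fin n → ℤ) × (Fin n → ℤ) → ℝ≥0∞ := fun Q =>
    σ (dyadicBox Q) ^ (-(1 / p.conjExponent)) * ∫⁻ x in dyadicBox Q, f x with ha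
  have hterm : ∀ Q, (σ (doubledBox Q) ^ (-(1 / p.conjExponent)) *
      ∫⁻ x in doubledBox Q, f x) ^ r ≤ c ^ (r - 1) * ∑ ε, a (dyadicShift ε Q) ^ r := by
    intro Q
    refine le_trans ?_ (ENNReal.rpow_sum_le_const_mul_sum_rpow Finset.univ
      (fun ε => a (dyadicShift ε Q)) (hp.trans hpr).le)
    refine ENNReal.rpow_le_rpow ?_ (by linarith)
    calc σ (doubledBox Q) ^ (-(1 / p.conjExponent)) * ∫⁻ x in doubledBox Q, f x
        ≤ σ (doubledBox Q) ^ (-(1 / p.conjExponent)) *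
          ∑ ε, ∫⁻ x in dyadicBox (dyadicShift ε Q), f x := by
          gcongr
          rw [← tsum_fintype (L := .unconditional _)]
          exact (lintegral_mono_set (doubledBox_subset_iUnion Q)).trans (lintegral_iUnion_le _ _)
      _ ≤ ∑ ε, a (dyadicShift ε Q) := by
          rw [Finset.mul_sum]
          refine Finset.sum_le_sum fun ε _ => ?_
          simp only [ha]
          -- The exponent of σ is negative, so the smaller box has the larger factor.
          gcongr ?_ * _
          rw [ENNReal.rpow_neg, ENNReal.rpow_neg, ENNReal.inv_le_inv]
          gcongr
          exact dyadicBox_shift_subset ε Q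
  calc _ ≤ ∑' Q, c ^ (r - 1) * ∑ ε, a (dyadicShift ε Q) ^ r := ENNReal.tsum_le_tsum hterm
    _ = c ^ (r - 1) * ∑ ε, ∑' Q, a (dyadicShift ε Q) ^ r := by
        rw [ENNReal.tsum_mul_left, Summable.tsum_finsetSum fun _ _ => ENNReal.summable]
    _ ≤ c ^ (r - 1) * ∑ _ε : Fin n → Fin 2, C * (∫⁻ x, f x ^ p * w x) ^ (r / p) := by
        gcongr with ε
        exact (ENNReal.tsum_comp_le_tsum_of_injective (dyadicShift_injective ε)
          fun Q => a Q ^ r).trans (hbound f hf hI)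
    _ = _ := by
        rw [Finset.sum_const, Finset.card_univ, nsmul_eq_mul, ← hc]
        ring

end DoubledBoxes

/-! ### Exponents in the two-weight condition. -/

theorem ENNReal.prod_rpow_eq_rpow_sum {ι : Type*} {x : ℝ≥0∞} (h0 : x ≠ 0) (h1 : x ≠ ∞)
    (s : Finset ι) (f : ι → ℝ) : ∏ i ∈ s, x ^ f i = x ^ ∑ i ∈ s, f i := by
  classical
  induction s using Finset.induction_on with
  | empty => simp
  | insert a s ha ih =>
    rw [Finset.prod_insert ha, Finset.sum_insert ha, ih, ENNReal.rpow_add _ _ h0 h1]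

/-- The powers of the volume in the two-weight condition combine. -/
theorem twoWeight_term_eq {n m : ℕ} {α p q : ℝ} {ps : Fin m → ℝ} (hn : n ≠ 0) (hm : m ≠ 0)
    (hps : ∀ i, 1 < ps i) (hp : 1 / p = ∑ i, 1 / ps i) (hq : 0 < q) {V : ℝ≥0∞} (h0 : V ≠ 0)
    (h1 : V ≠ ∞) (A : ℝ≥0∞) (S : Fin m → ℝ≥0∞) :
    V ^ (α / n + 1 / q - 1 / p) * (A / V) ^ (1 / q) *
        ∏ i, (S i / V) ^ (1 / (ps i).conjExponent) =
      A ^ (1 / q) * ∏ i, S i ^ (1 / (ps i).conjExponent) / V ^ (1 - α / ((m : ℝ) * n)) := by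
  have hn0 : (n : ℝ) ≠ 0 := by exact_mod_cast hn
  have hm0 : (m : ℝ) ≠ 0 := by exact_mod_cast hm
  have hpq := fun i => Real.HolderConjugate.conjExponent (hps i)
  have hdiv : ∀ (a : ℝ≥0∞) {t : ℝ}, 0 ≤ t → (a / V) ^ t = a ^ t * V ^ (-t) := fun a t ht => by
    rw [ENNReal.div_rpow_of_nonneg _ _ ht, div_eq_mul_inv, ENNReal.rpow_neg]
  have e1 : ∀ i, (S i / V) ^ (1 / (ps i).conjExponent) =
      S i ^ (1 / (ps i).conjExponent) * V ^ (-(1 / (ps i).conjExponent)) := fun i =>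
    hdiv _ (one_div_nonneg.2 (hpq i).symm.nonneg)
  have e2 : ∀ i, S i ^ (1 / (ps i).conjExponent) / V ^ (1 - α / ((m : ℝ) * n)) =
      S i ^ (1 / (ps i).conjExponent) * V ^ (-(1 - α / ((m : ℝ) * n))) := fun i => by
    rw [div_eq_mul_inv, ENNReal.rpow_neg]
  simp_rw [e1, e2, Finset.prod_mul_distrib, hdiv A (one_div_nonneg.2 hq.le),
    ENNReal.prod_rpow_eq_rpow_sum h0 h1]
  -- Both sides equal α/n - m, since 1/pᵢ' = 1 - 1/pᵢ and ∑ 1/pᵢ = 1/p.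
  have hexp : ∑ _i : Fin m, -(1 - α / ((m : ℝ) * n)) =
      (α / n + 1 / q - 1 / p) + (-(1 / q)) + ∑ i, -(1 / (ps i).conjExponent) := by
    have : ∀ i, 1 / (ps i).conjExponent = 1 - 1 / ps i := fun i => by
      have := (hpq i).inv_add_inv_eq_one
      simp only [one_div]
      linarith
    simp_rw [this, Finset.sum_neg_distrib, Finset.sum_sub_distrib, ← hp]
    simp only [Finset.sum_const, Finset.card_univ, Fintype.card_fin, nsmul_eq_mul]
    field_simp
    ring
  rw [hexp, ENNReal.rpow_add _ _ h0 h1, ENNReal.rpow_add _ _ h0 h1]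
  ring

/-! ### From the two-weight condition to a bound on the maximal operator. -/

section Sufficiency

variable {n m : ℕ}

/-- The two-weight condition on a countable family of rectangles which satisfies a Carleson
embedding and covers the rectangles of `𝓑` controls the maximal operator over `𝓑`. -/
theorem exists_maximal_le {ι : Type*} [Countable ι] {E : ι → Set (Fin n → ℝ)}
    {𝓑 : Set (Set (Fin n → ℝ))} {α p q : ℝ} {ps : Fin m → ℝ}
    (hαmn : α < (m : ℝ) * n) (hn : n ≠ 0) (hm : m ≠ 0)
    (hps : ∀ i, 1 < ps i) (hp : 1 / p = ∑ i, 1 / ps i) (hp0 : 0 < p) (hpq : p < q)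
    {ω : Fin m → (Fin n → ℝ) → ℝ≥0} {ν : (Fin n → ℝ) → ℝ≥0}
    (hRD : ∀ i, DyadicReverseDoubling (dualWeight (ps i) (ω i)))
    {c : ℝ≥0∞} (hc0 : c ≠ 0) (hc : c ≠ ∞) (hEax : ∀ Q, E Q ∈ axisRectangles n)
    (hE : ∀ Q, E Q ∈ 𝓑)
    (hcover : ∀ R ∈ 𝓑, ∃ Q, R ⊆ E Q ∧ volume (E Q) ≤ c * volume R)
    (hcarl : ∀ i, ∀ r, ps i < r → ∃ C : ℝ≥0∞, C ≠ ∞ ∧ ∀ f : (Fin n → ℝ) → ℝ≥0∞,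
      AEMeasurable f volume → ∫⁻ x, f x ^ ps i * ω i x ≠ ∞ →
      ∑' Q, (volume.withDensity (dualWeight (ps i) (ω i)) (E Q) ^ (-(1 / (ps i).conjExponent)) *
        ∫⁻ x in E Q, f x) ^ r ≤ C * (∫⁻ x, f x ^ ps i * ω i x) ^ (r / ps i))
    (hK : twoWeightConstant 𝓑 α p q ps ω ν < ∞) :
    ∃ C : ℝ≥0∞, C ≠ ∞ ∧ ∀ f : Fin m → (Fin n → ℝ) → ℝ≥0∞, (∀ i, AEMeasurable (f i) volume) →
      (∀ i, ∫⁻ x, f i x ^ ps i * ω i x ≠ ∞) →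
      ∃ G : (Fin n → ℝ) → ℝ≥0∞, Measurable G ∧
        (∀ x, (⨆ R ∈ 𝓑, ⨆ _ : x ∈ R,
          ∏ i, (∫⁻ y in R, f i y) / volume R ^ (1 - α / ((m : ℝ) * n))) ≤ G x) ∧
        (∫⁻ x, G x ^ q ∂weightMeasure ν) ^ (1 / q) ≤
          C * ∏ i, (∫⁻ x, f i x ^ ps i * ω i x) ^ (1 / ps i) := by
  have hq0 : 0 < q := hp0.trans hpq
  have hps0 : ∀ i, 0 < ps i := fun i => zero_lt_one.trans (hps i)
  have hmn : (0 : ℝ) < (m : ℝ) * n := by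
    have : 0 < m * n := Nat.mul_pos (Nat.pos_of_ne_zero hm) (Nat.pos_of_ne_zero hn)
    exact_mod_cast this
  set γ := 1 - α / ((m : ℝ) * n) with hγ
  have hγ0 : 0 < γ := by rw [hγ, sub_pos, div_lt_one hmn]; exact hαmn
  have hV0 : ∀ Q, volume (E Q) ≠ 0 := fun Q => volume_ne_zero_of_mem_axisRectangles (hEax Q)
  have hV1 : ∀ Q, volume (E Q) ≠ ∞ := fun Q => volume_ne_top_of_mem_axisRectangles (hEax Q)
  have hEm : ∀ Q, MeasurableSet (E Q) := fun Q => measurableSet_of_mem_axisRectangles (hEax Q)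
  set σ : Fin m → Measure (Fin n → ℝ) := fun i => volume.withDensity (dualWeight (ps i) (ω i))
  have hσ0 : ∀ i Q, σ i (E Q) ≠ 0 := fun i Q =>
    withDensity_ne_zero (hRD i).1 (dualWeight_pos (hps i) (ω i)) (hV0 Q)
  have hσ1 : ∀ i Q, σ i (E Q) ≠ ∞ := fun i Q => (hRD i).withDensity_ne_top (hEax Q)
  set K := twoWeightConstant 𝓑 α p q ps ω ν with hKdef
  have hKQ : ∀ Q, weightMeasure ν (E Q) ^ (1 / q) *
      ∏ i, σ i (E Q) ^ (1 / (ps i).conjExponent) / volume (E Q) ^ γ ≤ K := by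
    intro Q
    rw [← twoWeight_term_eq hn hm hps hp hq0 (hV0 Q) (hV1 Q), hKdef, twoWeightConstant]
    refine le_trans (le_of_eq ?_) (le_iSup₂ (E Q) (hE Q))
    simp only [σ, weightMeasure, withDensity_apply _ (hEm Q)]
  -- Hölder's inequality with weights p/pᵢ produces the exponents q pᵢ/p; p < q puts them in the
  -- range of the embedding.
  have hr : ∀ i, ps i < q * ps i / p := fun i => by
    rw [lt_div_iff₀ hp0, mul_comm q]; exact mul_lt_mul_of_pos_left hpq (hps0 i)
  choose C hC hbound using fun i => hcarl i _ (hr i)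
  refine ⟨(c ^ γ) ^ m * (K * ∏ i, C i ^ (p / ps i / q)), ENNReal.mul_ne_top
    (ENNReal.pow_ne_top (ENNReal.rpow_ne_top_of_nonneg hγ0.le hc)) (ENNReal.mul_ne_top hK.ne
    (ENNReal.prod_ne_top fun i _ => ENNReal.rpow_ne_top_of_nonneg
      (div_nonneg (div_nonneg hp0.le (hps0 i).le) hq0.le) (hC i))), fun f hf hI => ?_⟩
  set a : Fin m → ι → ℝ≥0∞ := fun i Q =>
    σ i (E Q) ^ (-(1 / (ps i).conjExponent)) * ∫⁻ x in E Q, f i x with ha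
  set T : ι → ℝ≥0∞ := fun Q => ∏ i, (∫⁻ y in E Q, f i y) / volume (E Q) ^ γ with hT
  have hTK : ∀ Q, T Q ^ q * weightMeasure ν (E Q) ≤ K ^ q * ∏ i, a i Q ^ q := by
    intro Q
    have h1 : T Q * weightMeasure ν (E Q) ^ (1 / q) ≤ K * ∏ i, a i Q := by
      calc T Q * weightMeasure ν (E Q) ^ (1 / q)
          = (weightMeasure ν (E Q) ^ (1 / q) *
            ∏ i, σ i (E Q) ^ (1 / (ps i).conjExponent) / volume (E Q) ^ γ) * ∏ i, a i Q := by
            rw [mul_assoc, ← Finset.prod_mul_distrib, mul_comm, hT]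
            congr 1
            refine Finset.prod_congr rfl fun i _ => ?_
            have : σ i (E Q) ^ (1 / (ps i).conjExponent) *
                σ i (E Q) ^ (-(1 / (ps i).conjExponent)) = 1 := by
              rw [← ENNReal.rpow_add _ _ (hσ0 i Q) (hσ1 i Q), add_neg_cancel, ENNReal.rpow_zero]
            calc (∫⁻ y in E Q, f i y) / volume (E Q) ^ γ
                = (σ i (E Q) ^ (1 / (ps i).conjExponent) *
                  σ i (E Q) ^ (-(1 / (ps i).conjExponent))) *
                  ((∫⁻ y in E Q, f i y) / volume (E Q) ^ γ) := by rw [this, one_mul]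
              _ = _ := by simp only [ha, div_eq_mul_inv]; ring
        _ ≤ _ := by gcongr; exact hKQ Q
    calc T Q ^ q * weightMeasure ν (E Q) = (T Q * weightMeasure ν (E Q) ^ (1 / q)) ^ q := by
          rw [ENNReal.mul_rpow_of_nonneg _ _ hq0.le, ← ENNReal.rpow_mul,
            one_div_mul_cancel hq0.ne', ENNReal.rpow_one]
      _ ≤ (K * ∏ i, a i Q) ^ q := by gcongr
      _ = _ := by
          rw [ENNReal.mul_rpow_of_nonneg _ _ hq0.le, ENNReal.prod_rpow_of_nonneg hq0.le]
  have hsum : ∑' Q, T Q ^ q * weightMeasure ν (E Q) ≤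
      K ^ q * ∏ i, (C i * (∫⁻ x, f i x ^ ps i * ω i x) ^ (q * ps i / p / ps i)) ^ (p / ps i) := by
    calc _ ≤ ∑' Q, K ^ q * ∏ i, a i Q ^ q := ENNReal.tsum_le_tsum hTK
      _ = K ^ q * ∑' Q, ∏ i, (a i Q ^ (q * ps i / p)) ^ (p / ps i) := by
          rw [ENNReal.tsum_mul_left]
          congr 1
          refine tsum_congr fun Q => Finset.prod_congr rfl fun i _ => ?_
          rw [← ENNReal.rpow_mul]
          congr 1
          have := (hps0 i).ne'
          field_simp
      _ ≤ K ^ q * ∏ i, (∑' Q, a i Q ^ (q * ps i / p)) ^ (p / ps i) := by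
          gcongr
          let _ : MeasurableSpace ι := ⊤
          have := ENNReal.lintegral_prod_norm_pow_le (μ := Measure.count) Finset.univ
            (f := fun i Q => a i Q ^ (q * ps i / p))
            (fun i _ => (measurable_of_countable _).aemeasurable) (p := fun i => p / ps i)
            (by
              simp only [div_eq_mul_one_div p]
              rw [← Finset.mul_sum, ← hp, mul_one_div_cancel hp0.ne'])
            (fun i _ => div_nonneg hp0.le (hps0 i).le)
          simpa only [lintegral_count] using this
      _ ≤ _ := by
          gcongr with i
          · exact div_nonneg hp0.le (hps0 i).le
          · exact hbound i (f i) (hf i) (hI i)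
  -- The supremum is replaced by an ℓ^q sum over a countable family, hence a measurable one; c^γ is
  -- lost in each of the m factors on enlarging R to `E Q`.
  set G : (Fin n → ℝ) → ℝ≥0∞ := fun x =>
    (c ^ γ) ^ m * (∑' Q, (E Q).indicator (fun _ => T Q ^ q) x) ^ (1 / q) with hG
  have hGm : Measurable fun x => ∑' Q, (E Q).indicator (fun _ => T Q ^ q) x :=
    Measurable.tsum fun Q => measurable_const.indicator (hEm Q)
  refine ⟨G, (hGm.pow_const _).const_mul _, fun x => ?_, ?_⟩
  · refine iSup₂_le fun R hR => iSup_le fun hx => ?_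
    obtain ⟨Q, hRQ, hvol⟩ := hcover R hR
    have hR0 : volume R ≠ 0 := fun h => hV0 Q (le_antisymm (by simpa [h] using hvol) bot_le)
    calc ∏ i, (∫⁻ y in R, f i y) / volume R ^ γ
        ≤ ∏ i, c ^ γ * ((∫⁻ y in E Q, f i y) / volume (E Q) ^ γ) := by
          refine Finset.prod_le_prod' fun i _ => ?_
          have hcγ0 : c ^ γ ≠ 0 := by simp [ENNReal.rpow_eq_zero_iff, hc0, hc]
          have hcγ1 : c ^ γ ≠ ∞ := ENNReal.rpow_ne_top_of_nonneg hγ0.le hc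
          calc (∫⁻ y in R, f i y) / volume R ^ γ ≤ (∫⁻ y in E Q, f i y) / volume R ^ γ := by
                gcongr
            _ = c ^ γ * ((∫⁻ y in E Q, f i y) / (c * volume R) ^ γ) := by
                rw [ENNReal.mul_rpow_of_nonneg _ _ hγ0.le, div_eq_mul_inv, div_eq_mul_inv,
                  ENNReal.mul_inv (Or.inl hcγ0) (Or.inl hcγ1), mul_left_comm, ← mul_assoc (c ^ γ),
                  ENNReal.mul_inv_cancel hcγ0 hcγ1, one_mul]
            _ ≤ _ := by gcongr
      _ = (c ^ γ) ^ m * T Q := by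
          rw [Finset.prod_mul_distrib, Finset.prod_const, Finset.card_univ, Fintype.card_fin]
      _ ≤ G x := by
          rw [hG]
          dsimp only
          gcongr
          calc T Q = ((E Q).indicator (fun _ => T Q ^ q) x) ^ (1 / q) := by
                rw [Set.indicator_of_mem (hRQ hx), ← ENNReal.rpow_mul, mul_one_div_cancel hq0.ne',
                  ENNReal.rpow_one]
            _ ≤ _ := by
                gcongr
                exact ENNReal.le_tsum Q
  · have hint : ∫⁻ x, G x ^ q ∂weightMeasure ν =
        ((c ^ γ) ^ m) ^ q * ∑' Q, T Q ^ q * weightMeasure ν (E Q) := by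
      simp only [hG, ENNReal.mul_rpow_of_nonneg _ _ hq0.le, ← ENNReal.rpow_mul,
        one_div_mul_cancel hq0.ne', ENNReal.rpow_one]
      rw [lintegral_const_mul _ hGm,
        lintegral_tsum fun Q => (measurable_const.indicator (hEm Q)).aemeasurable]
      congr 1
      exact tsum_congr fun Q => lintegral_indicator_const (hEm Q) _
    rw [hint]
    calc _ ≤ (((c ^ γ) ^ m) ^ q * (K ^ q *
          ∏ i, (C i * (∫⁻ x, f i x ^ ps i * ω i x) ^ (q * ps i / p / ps i)) ^ (p / ps i))) ^
            (1 / q) := by gcongr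
      _ = _ := by
          have hqi : 0 ≤ 1 / q := by positivity
          rw [ENNReal.mul_rpow_of_nonneg _ _ hqi, ENNReal.mul_rpow_of_nonneg _ _ hqi,
            ← ENNReal.rpow_mul, ← ENNReal.rpow_mul, mul_one_div_cancel hq0.ne', ENNReal.rpow_one,
            ENNReal.rpow_one, ← ENNReal.prod_rpow_of_nonneg hqi, mul_assoc, mul_assoc,
            ← Finset.prod_mul_distrib]
          congr 2
          refine Finset.prod_congr rfl fun i _ => ?_
          have h1 := (hps0 i).ne'
          have h2 : 0 ≤ p / ps i := div_nonneg hp0.le (hps0 i).le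
          rw [← ENNReal.rpow_mul, ENNReal.mul_rpow_of_nonneg _ _ (mul_nonneg h2 hqi),
            ← ENNReal.rpow_mul]
          congr 2 <;> field_simp

/-- Transfers measurability of the fᵢ from the weighted measure to Lebesgue measure. -/
theorem DyadicReverseDoubling.volume_absolutelyContinuous {p : ℝ} (hp : 1 < p)
    {w : (Fin n → ℝ) → ℝ≥0} (hw : AEMeasurable w volume)
    (hRD : DyadicReverseDoubling (dualWeight p w)) : volume ≪ weightMeasure w := by
  refine withDensity_absolutelyContinuous' hw.coe_nnreal_ennreal ?_
  filter_upwards [hRD.ae_weight_ne_zero hp] with x hx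
  exact_mod_cast hx

theorem eLpNorm_weightMeasure_eq {𝕜 : Type*} [RCLike 𝕜] {p : ℝ} (hp : 0 < p)
    {w : (Fin n → ℝ) → ℝ≥0} (hw : AEMeasurable w volume) {f : (Fin n → ℝ) → 𝕜}
    (hf : AEStronglyMeasurable f volume) :
    eLpNorm f (ENNReal.ofReal p) (weightMeasure w) = (∫⁻ x, ‖f x‖ₑ ^ p * w x) ^ (1 / p) := by
  rw [eLpNorm_eq_lintegral_rpow_enorm_toReal (by simpa using hp) ENNReal.ofReal_ne_top,
    ENNReal.toReal_ofReal hp.le, weightMeasure,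
    lintegral_withDensity_eq_lintegral_mul₀ hw.coe_nnreal_ennreal (hf.enorm.pow_const _)]
  simp only [Pi.mul_apply, mul_comm]

theorem eLpNorm_ennreal_eq {X : Type*} [MeasurableSpace X] {μ : Measure X} {q : ℝ} (hq : 0 < q)
    (g : X → ℝ≥0∞) : eLpNorm g (ENNReal.ofReal q) μ = (∫⁻ x, g x ^ q ∂μ) ^ (1 / q) := by
  rw [eLpNorm_eq_lintegral_rpow_enorm_toReal (by simpa using hq) ENNReal.ofReal_ne_top,
    ENNReal.toReal_ofReal hq.le]
  simp only [enorm_eq_self]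

/-- Chebyshev's inequality for the majorant `G`, so that `g` need not be measurable. -/
theorem weakLpNorm_le_of_le {X : Type*} [MeasurableSpace X] {μ : Measure X} {q : ℝ} (hq : 0 < q)
    {g G : X → ℝ≥0∞} (hG : Measurable G) (h : ∀ x, g x ≤ G x) :
    weakLpNorm g q μ ≤ (∫⁻ x, G x ^ q ∂μ) ^ (1 / q) := by
  refine iSup_le fun t => ?_
  calc (t : ℝ≥0∞) * μ {x | (t : ℝ≥0∞) < g x} ^ (1 / q)
      = ((t : ℝ≥0∞) ^ q * μ {x | (t : ℝ≥0∞) < g x}) ^ (1 / q) := by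
        rw [ENNReal.mul_rpow_of_nonneg _ _ (by positivity), ← ENNReal.rpow_mul,
          mul_one_div_cancel hq.ne', ENNReal.rpow_one]
    _ ≤ ((t : ℝ≥0∞) ^ q * μ {x | (t : ℝ≥0∞) ^ q ≤ G x ^ q}) ^ (1 / q) := by
        gcongr with x
        intro hx
        exact ENNReal.rpow_le_rpow (hx.le.trans (h x)) hq.le
    _ ≤ _ := by
        gcongr
        exact mul_meas_ge_le_lintegral (hG.pow_const q) _

end Sufficiency

/-! ### Norm bounds and necessity of the two-weight condition. -/

section TypeBounds

variable {n m : ℕ} {𝕜 : Type*} [RCLike 𝕜]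

theorem typeBounds_of_maximal_le {𝓑 : Set (Set (Fin n → ℝ))} {α q : ℝ} {ps : Fin m → ℝ}
    (hps : ∀ i, 1 < ps i) (hq : 0 < q)
    {ω : Fin m → (Fin n → ℝ) → ℝ≥0} (hω : ∀ i, AEMeasurable (ω i) volume)
    {ν : (Fin n → ℝ) → ℝ≥0}
    (hRD : ∀ i, DyadicReverseDoubling (dualWeight (ps i) (ω i)))
    (h : ∃ C : ℝ≥0∞, C ≠ ∞ ∧ ∀ f : Fin m → (Fin n → ℝ) → ℝ≥0∞, (∀ i, AEMeasurable (f i) volume) →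
      (∀ i, ∫⁻ x, f i x ^ ps i * ω i x ≠ ∞) →
      ∃ G : (Fin n → ℝ) → ℝ≥0∞, Measurable G ∧
        (∀ x, (⨆ R ∈ 𝓑, ⨆ _ : x ∈ R,
          ∏ i, (∫⁻ y in R, f i y) / volume R ^ (1 - α / ((m : ℝ) * n))) ≤ G x) ∧
        (∫⁻ x, G x ^ q ∂weightMeasure ν) ^ (1 / q) ≤
          C * ∏ i, (∫⁻ x, f i x ^ ps i * ω i x) ^ (1 / ps i)) :
    WeakTypeBound 𝕜 𝓑 α q ps ω ν ∧ StrongTypeBound 𝕜 𝓑 α q ps ω ν := by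
  obtain ⟨C, hC, hmax⟩ := h
  have hps0 : ∀ i, 0 < ps i := fun i => zero_lt_one.trans (hps i)
  have key : ∀ f : Fin m → (Fin n → ℝ) → 𝕜,
      (∀ i, MemLp (f i) (ENNReal.ofReal (ps i)) (weightMeasure (ω i))) →
      ∃ G : (Fin n → ℝ) → ℝ≥0∞, Measurable G ∧
        (∀ x, multilinearFractionalMaximal 𝓑 α f x ≤ G x) ∧
        (∫⁻ x, G x ^ q ∂weightMeasure ν) ^ (1 / q) ≤ (C.toNNReal : ℝ≥0∞) *
          ∏ i, eLpNorm (f i) (ENNReal.ofReal (ps i)) (weightMeasure (ω i)) := by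
    intro f hf
    have hfm : ∀ i, AEStronglyMeasurable (f i) volume := fun i =>
      (hf i).1.mono_ac ((hRD i).volume_absolutelyContinuous (hps i) (hω i))
    have hnorm := fun i => eLpNorm_weightMeasure_eq (hps0 i) (hω i) (hfm i)
    simp_rw [hnorm, ENNReal.coe_toNNReal hC]
    refine hmax (fun i x => ‖f i x‖ₑ) (fun i => (hfm i).enorm) fun i hi => ?_
    have := (hf i).2
    rw [hnorm i, hi, ENNReal.top_rpow_of_pos (one_div_pos.2 (hps0 i))] at this
    exact this.ne rfl
  refine ⟨⟨C.toNNReal, fun f hf => ?_⟩, ⟨C.toNNReal, fun f hf => ?_⟩⟩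
  · obtain ⟨G, hGm, hle, hG⟩ := key f hf
    exact (weakLpNorm_le_of_le hq hGm hle).trans hG
  · obtain ⟨G, hGm, hle, hG⟩ := key f hf
    rw [eLpNorm_ennreal_eq hq]
    refine le_trans ?_ hG
    gcongr with x
    exact hle x

theorem le_multilinearFractionalMaximal {𝓑 : Set (Set (Fin n → ℝ))} (α : ℝ)
    (f : Fin m → (Fin n → ℝ) → 𝕜) {R : Set (Fin n → ℝ)} (hR : R ∈ 𝓑) {x : Fin n → ℝ} (hx : x ∈ R) :
    ∏ i, (∫⁻ y in R, ‖f i y‖ₑ) / volume R ^ (1 - α / ((m : ℝ) * n)) ≤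
      multilinearFractionalMaximal 𝓑 α f x :=
  le_iSup₂_of_le R hR (le_iSup_of_le hx le_rfl)

/-- The level sets in the weak norm are strict, so the levels t < T are used and t tends to T. -/
theorem mul_rpow_le_weakLpNorm {X : Type*} [MeasurableSpace X] {μ : Measure X} {q : ℝ}
    (hq : 0 < q) {g : X → ℝ≥0∞} {R : Set X} {T : ℝ≥0∞} (h : ∀ x ∈ R, T ≤ g x) :
    T * μ R ^ (1 / q) ≤ weakLpNorm g q μ := by
  refine ENNReal.mul_le_of_forall_lt fun t ht s hs => ?_
  lift t to ℝ≥0 using ht.ne_top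
  refine le_trans ?_ (le_iSup _ t)
  gcongr
  refine hs.le.trans ?_
  gcongr
  exact fun x hx => ht.trans_le (h x hx)

theorem mul_rpow_le_eLpNorm {X : Type*} [MeasurableSpace X] {μ : Measure X} {q : ℝ}
    (hq : 0 < q) {g : X → ℝ≥0∞} {R : Set X} (hR : MeasurableSet R) {T : ℝ≥0∞}
    (h : ∀ x ∈ R, T ≤ g x) : T * μ R ^ (1 / q) ≤ eLpNorm g (ENNReal.ofReal q) μ := by
  rw [eLpNorm_ennreal_eq hq]
  calc T * μ R ^ (1 / q) = (∫⁻ _ in R, T ^ q ∂μ) ^ (1 / q) := by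
        rw [setLIntegral_const, ENNReal.mul_rpow_of_nonneg _ _ (by positivity), ← ENNReal.rpow_mul,
          mul_one_div_cancel hq.ne', ENNReal.rpow_one]
    _ ≤ _ := by
        refine ENNReal.rpow_le_rpow (le_trans ?_ (setLIntegral_le_lintegral R _)) (by positivity)
        exact setLIntegral_mono' hR fun x hx => ENNReal.rpow_le_rpow (h x hx) hq.le

/-- Testing on the dual weights: a bound on single rectangles, which both the weak and the strong
type bound imply, gives the two-weight condition. -/
theorem twoWeightConstant_lt_top {𝓑 : Set (Set (Fin n → ℝ))} {α p q : ℝ} {ps : Fin m → ℝ}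
    (hn : n ≠ 0) (hm : m ≠ 0) (hps : ∀ i, 1 < ps i) (hp : 1 / p = ∑ i, 1 / ps i) (hq : 0 < q)
    {ω : Fin m → (Fin n → ℝ) → ℝ≥0} (hω : ∀ i, AEMeasurable (ω i) volume)
    {ν : (Fin n → ℝ) → ℝ≥0}
    (hRD : ∀ i, DyadicReverseDoubling (dualWeight (ps i) (ω i)))
    (h𝓑 : 𝓑 ⊆ axisRectangles n)
    (h : ∃ C : ℝ≥0, ∀ f : Fin m → (Fin n → ℝ) → 𝕜,
      (∀ i, MemLp (f i) (ENNReal.ofReal (ps i)) (weightMeasure (ω i))) → ∀ R ∈ 𝓑,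
      (∏ i, (∫⁻ y in R, ‖f i y‖ₑ) / volume R ^ (1 - α / ((m : ℝ) * n))) *
        weightMeasure ν R ^ (1 / q) ≤
          C * ∏ i, eLpNorm (f i) (ENNReal.ofReal (ps i)) (weightMeasure (ω i))) :
    twoWeightConstant 𝓑 α p q ps ω ν < ∞ := by
  obtain ⟨C, hC⟩ := h
  refine lt_of_le_of_lt (iSup₂_le fun R hR => ?_) (ENNReal.coe_lt_top (r := C))
  have hRm := measurableSet_of_mem_axisRectangles (h𝓑 hR)
  have hV0 := volume_ne_zero_of_mem_axisRectangles (h𝓑 hR)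
  have hps0 : ∀ i, 0 < ps i := fun i => zero_lt_one.trans (hps i)
  have hpc := fun i => Real.HolderConjugate.conjExponent (hps i)
  rw [twoWeight_term_eq hn hm hps hp hq hV0 (volume_ne_top_of_mem_axisRectangles (h𝓑 hR))]
  set S : Fin m → ℝ≥0∞ := fun i => ∫⁻ x in R, dualWeight (ps i) (ω i) x with hS
  have hSσ : ∀ i, S i = volume.withDensity (dualWeight (ps i) (ω i)) R := fun i =>
    (withDensity_apply _ hRm).symm
  have hS0 : ∀ i, S i ≠ 0 := fun i => hSσ i ▸
    withDensity_ne_zero (hRD i).1 (dualWeight_pos (hps i) (ω i)) hV0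
  have hS1 : ∀ i, S i ≠ ∞ := fun i => hSσ i ▸ (hRD i).withDensity_ne_top (h𝓑 hR)
  -- The dual weight on R. It is finite almost everywhere, so `toReal` loses nothing; ∫_R f and ∫
  -- f^p ω both equal σ(R), because p(1 - p') + 1 = 1 - p'.
  let f : Fin m → (Fin n → ℝ) → 𝕜 := fun i x =>
    ((R.indicator (dualWeight (ps i) (ω i)) x).toReal : 𝕜)
  have hfm : ∀ i, AEStronglyMeasurable (f i) volume := fun i =>
    (RCLike.continuous_ofReal.measurable.comp_aemeasurable
      ((hRD i).1.indicator hRm).ennreal_toReal).aestronglyMeasurable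
  have hfe : ∀ i, ∀ᵐ x, ‖f i x‖ₑ = R.indicator (dualWeight (ps i) (ω i)) x := by
    intro i
    filter_upwards [(hRD i).ae_lt_top] with x hx
    have hx' : R.indicator (dualWeight (ps i) (ω i)) x ≠ ∞ :=
      ne_top_of_le_ne_top hx.ne (Set.indicator_le_self _ _ x)
    rw [← ofReal_norm, RCLike.norm_ofReal, abs_of_nonneg ENNReal.toReal_nonneg,
      ENNReal.ofReal_toReal hx']
  have hf1 : ∀ i, ∫⁻ y in R, ‖f i y‖ₑ = S i := fun i => by
    rw [lintegral_congr_ae (ae_restrict_of_ae (hfe i)), hS]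
    exact setLIntegral_congr_fun hRm fun x hx => Set.indicator_of_mem hx _
  have hfp : ∀ i, eLpNorm (f i) (ENNReal.ofReal (ps i)) (weightMeasure (ω i)) =
      S i ^ (1 / ps i) := fun i => by
    rw [eLpNorm_weightMeasure_eq (hps0 i) (hω i) (hfm i), hS]
    dsimp only
    rw [← lintegral_indicator hRm]
    congr 1
    refine lintegral_congr_ae ?_
    filter_upwards [hfe i, (hRD i).ae_weight_ne_zero (hps i)] with x hx hx0
    rw [hx]
    by_cases hxR : x ∈ R
    · have hx0' : (ω i x : ℝ≥0∞) ≠ 0 := by exact_mod_cast hx0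
      rw [Set.indicator_of_mem hxR, dualWeight, ← ENNReal.rpow_mul]
      conv_lhs => rw [← ENNReal.rpow_one (ω i x : ℝ≥0∞), ← ENNReal.rpow_mul, one_mul]
      rw [← ENNReal.rpow_add _ _ hx0' ENNReal.coe_ne_top]
      congr 1
      have := (hpc i).mul_eq_add
      linarith
    · simp [hxR, hps0 i]
  have hmem : ∀ i, MemLp (f i) (ENNReal.ofReal (ps i)) (weightMeasure (ω i)) := fun i =>
    ⟨(hfm i).mono_ac (withDensity_absolutelyContinuous _ _), by
      rw [hfp i]
      exact (ENNReal.rpow_ne_top_of_nonneg (one_div_nonneg.2 (hps0 i).le) (hS1 i)).lt_top⟩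
  have hb := hC f hmem R hR
  simp_rw [hf1, hfp] at hb
  have hP0 : ∏ i, S i ^ (1 / ps i) ≠ 0 := Finset.prod_ne_zero_iff.2 fun i _ => by
    simp [ENNReal.rpow_eq_zero_iff, hS0 i, hS1 i]
  have hP1 : ∏ i, S i ^ (1 / ps i) ≠ ∞ := ENNReal.prod_ne_top fun i _ =>
    ENNReal.rpow_ne_top_of_nonneg (one_div_nonneg.2 (hps0 i).le) (hS1 i)
  -- Restore the cancelled norms ∏ σᵢ(R)^(1/pᵢ): σ^(1/p') σ^(1/p) = σ turns the condition into the
  -- tested bound.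
  rw [← ENNReal.mul_le_mul_iff_left hP0 hP1]
  refine le_trans (le_of_eq ?_) hb
  rw [mul_assoc, ← Finset.prod_mul_distrib, mul_comm, weightMeasure, withDensity_apply _ hRm]
  congr 1
  refine Finset.prod_congr rfl fun i _ => ?_
  rw [div_eq_mul_inv, mul_right_comm, ← ENNReal.rpow_add _ _ (hS0 i) (hS1 i), ← div_eq_mul_inv]
  have := (hpc i).inv_add_inv_eq_one
  rw [one_div, one_div, add_comm, this, ENNReal.rpow_one]

theorem StrongTypeBound.twoWeightConstant_lt_top {𝓑 : Set (Set (Fin n → ℝ))} {α p q : ℝ}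
    {ps : Fin m → ℝ} (hn : n ≠ 0) (hm : m ≠ 0) (hps : ∀ i, 1 < ps i)
    (hp : 1 / p = ∑ i, 1 / ps i) (hq : 0 < q)
    {ω : Fin m → (Fin n → ℝ) → ℝ≥0} (hω : ∀ i, AEMeasurable (ω i) volume)
    {ν : (Fin n → ℝ) → ℝ≥0} (hRD : ∀ i, DyadicReverseDoubling (dualWeight (ps i) (ω i)))
    (h𝓑 : 𝓑 ⊆ axisRectangles n) (h : StrongTypeBound 𝕜 𝓑 α q ps ω ν) :
    twoWeightConstant 𝓑 α p q ps ω ν < ∞ := by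
  obtain ⟨C, hC⟩ := h
  exact _root_.twoWeightConstant_lt_top (𝕜 := 𝕜) hn hm hps hp hq hω hRD h𝓑
    ⟨C, fun f hf R hR => (mul_rpow_le_eLpNorm hq (measurableSet_of_mem_axisRectangles (h𝓑 hR))
      fun x hx => le_multilinearFractionalMaximal α f hR hx).trans (hC f hf)⟩

theorem WeakTypeBound.twoWeightConstant_lt_top {𝓑 : Set (Set (Fin n → ℝ))} {α p q : ℝ}
    {ps : Fin m → ℝ} (hn : n ≠ 0) (hm : m ≠ 0) (hps : ∀ i, 1 < ps i)
    (hp : 1 / p = ∑ i, 1 / ps i) (hq : 0 < q)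
    {ω : Fin m → (Fin n → ℝ) → ℝ≥0} (hω : ∀ i, AEMeasurable (ω i) volume)
    {ν : (Fin n → ℝ) → ℝ≥0} (hRD : ∀ i, DyadicReverseDoubling (dualWeight (ps i) (ω i)))
    (h𝓑 : 𝓑 ⊆ axisRectangles n) (h : WeakTypeBound 𝕜 𝓑 α q ps ω ν) :
    twoWeightConstant 𝓑 α p q ps ω ν < ∞ := by
  obtain ⟨C, hC⟩ := h
  exact _root_.twoWeightConstant_lt_top (𝕜 := 𝕜) hn hm hps hp hq hω hRD h𝓑
    ⟨C, fun f hf R hR => (mul_rpow_le_weakLpNorm hq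
      fun x hx => le_multilinearFractionalMaximal α f hR hx).trans (hC f hf)⟩

theorem tfae_of_twoWeight_imp {𝓑 : Set (Set (Fin n → ℝ))} {α p q : ℝ}
    {ps : Fin m → ℝ} (hn : n ≠ 0) (hm : m ≠ 0) (hps : ∀ i, 1 < ps i)
    (hp : 1 / p = ∑ i, 1 / ps i) (hq : 0 < q)
    {ω : Fin m → (Fin n → ℝ) → ℝ≥0} (hω : ∀ i, AEMeasurable (ω i) volume)
    {ν : (Fin n → ℝ) → ℝ≥0} (hRD : ∀ i, DyadicReverseDoubling (dualWeight (ps i) (ω i)))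
    (h𝓑 : 𝓑 ⊆ axisRectangles n)
    (h : twoWeightConstant 𝓑 α p q ps ω ν < ∞ →
      WeakTypeBound 𝕜 𝓑 α q ps ω ν ∧ StrongTypeBound 𝕜 𝓑 α q ps ω ν) :
    [twoWeightConstant 𝓑 α p q ps ω ν < ∞, WeakTypeBound 𝕜 𝓑 α q ps ω ν,
      StrongTypeBound 𝕜 𝓑 α q ps ω ν].TFAE := by
  tfae_have 1 → 2 := fun h1 => (h h1).1
  tfae_have 1 → 3 := fun h1 => (h h1).2
  tfae_have 2 → 1 := fun h2 => h2.twoWeightConstant_lt_top hn hm hps hp hq hω hRD h𝓑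
  tfae_have 3 → 1 := fun h3 => h3.twoWeightConstant_lt_top hn hm hps hp hq hω hRD h𝓑
  tfae_finish

end TypeBounds

/-! ### The equivalences for both families. -/

theorem theorem2p1 (𝕜 : Type*) [RCLike 𝕜] (n m : ℕ) (α p q : ℝ) (ps : Fin m → ℝ)
    (hα : 0 < α) (hαmn : α < (m : ℝ) * n)
    (hps : ∀ i, 1 < ps i) (hp : 1 / p = ∑ i, 1 / ps i) (hp0 : 0 < p) (hpq : p < q)
    (ω : Fin m → (Fin n → ℝ) → ℝ≥0) (hω : ∀ i, AEMeasurable (ω i) volume)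
    (ν : (Fin n → ℝ) → ℝ≥0) (hν : AEMeasurable ν volume)
    (hRD : ∀ i, DyadicReverseDoubling (dualWeight (ps i) (ω i))) :
    [twoWeightConstant (axisRectangles n) α p q ps ω ν < ∞,
      WeakTypeBound 𝕜 (axisRectangles n) α q ps ω ν,
      StrongTypeBound 𝕜 (axisRectangles n) α q ps ω ν].TFAE ∧
    [twoWeightConstant (dyadicRectangles n) α p q ps ω ν < ∞,
      WeakTypeBound 𝕜 (dyadicRectangles n) α q ps ω ν,
      StrongTypeBound 𝕜 (dyadicRectangles n) α q ps ω ν].TFAE := by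
  -- The range 0 < α < mn already excludes m = 0 and n = 0.
  have hm : m ≠ 0 := by rintro rfl; simp at hαmn; linarith
  have hn : n ≠ 0 := by rintro rfl; simp at hαmn; linarith
  have hq : 0 < q := hp0.trans hpq
  refine ⟨tfae_of_twoWeight_imp hn hm hps hp hq hω hRD subset_rfl fun hK => ?_,
    tfae_of_twoWeight_imp hn hm hps hp hq hω hRD dyadicRectangles_subset fun hK => ?_⟩
  · exact typeBounds_of_maximal_le hps hq hω hRD
      (exists_maximal_le (E := doubledBox) (c := 4 ^ n) hαmn hn hm hps hp hp0 hpq hRD (by simp)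
        (by simp) doubledBox_mem doubledBox_mem (fun R hR => exists_doubledBox_superset hR)
        (fun i r hr => exists_tsum_doubledBox_le hn (hps i) hr (hω i) (hRD i)) hK)
  · exact typeBounds_of_maximal_le hps hq hω hRD
      (exists_maximal_le (E := dyadicBox) (c := 1) hαmn hn hm hps hp hp0 hpq hRD one_ne_zero
        ENNReal.one_ne_top (fun Q => dyadicRectangles_subset (dyadicBox_mem Q)) dyadicBox_mem
        (fun R hR => by
          obtain ⟨Q, rfl⟩ := exists_dyadicBox_eq hR
          exact ⟨Q, subset_rfl, by simp⟩)
        (fun i r hr => exists_tsum_dyadicBox_le hn (hps i) hr (hω i) (hRD i)) hK)
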